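/- All graphs are finite. For a connected graph $G$, the minimum genus $\gamma(G)$ and the maximum genus $\Gamma(G)$ are the least and the greatest $k$ such that $G$ has a cellular embedding in the closed orientable surface $S_k$ of genus $k$. Cellular embeddings are described by rotation systems (a cyclic ordering of the edge-ends at each vertex); their faces are the orbits of face tracing, and the genus $k$ is given by the Euler equation $|V|-|E|+|F|=2-2k$. A connected graph is upper-embeddable if it has a cellular embedding with one or two faces. Let $H_3$ be the graph obtained from $K_{2,3}$ by attaching a pendant vertex (a "free node") to each of its three vertices of degree 2. For a graph $G$ and a set $T$ of triples of distinct 2-valent vertices of $G$, let $H(G,T)$ be the graph obtained from $G$ by adding, for each triple $t\in T$, a copy of $H_3$ whose three free nodes are identified with the three vertices of $t$. * $G_6$ is the cycle with vertices $a_0,\dots,a_4,b_0,\dots,b_4,c_0,\dots,c_4$ in this cyclic order, and $M_6=H(G_6,\{\{a_i,b_i,c_i\}: 0\le i\le 4\})$. * $G_5$ is $G_6$ together with the edge $a_0b_0$, and $M_5=H(G_5,\{\{a_i,b_i,c_i\}: 1\le i\le 4\})$. * $G_4$ is the cycle with vertices $d_0,a_0,a_1,a_2,d_1,d_2,b_0,b_1,b_2,d_3,c_0,c_1,c_2$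 in this cyclic order together with the two edges $d_0d_2$ and $d_1d_3$, and $M_4=H(G_4,\{\{a_i,b_i,c_i\}: 0\le i\le 2\})$. **Corollary.** The maximum genera of $M_4$, $M_5$ and $M_6$ are $$\Gamma(M_4)=7,\qquad \Gamma(M_5)=9,\qquad \Gamma(M_6)=10,$$ and these three graphs are upper-embeddable. Moreover $$\gamma(M_4)=4,\qquad \gamma(M_5)=5,\qquad \gamma(M_6)=6,$$ so that $\Gamma(G)\ge 2\gamma(G)$ fails for each $G\in\{M_4,M_5,M_6\}$; that is, all three graphs are counterexamples to the conjecture of Nordhaus et al. that $\Gamma(G)\ge 2\gamma(G)$ for all graphs $G$. -/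

import Mathlib

namespace SimpleGraph

variable {V : Type*} (G : SimpleGraph V)

/-- A rotation system of a simple graph: a permutation `next` of its darts (the edge-ends, the dart
`d` being the end at `d.fst` of the edge `d.edge`) that preserves the vertex at which a dart is
based and is transitive on the darts based at each vertex, in other words a cyclic ordering of the
edge-ends at every vertex. Rotation systems of a connected graph stand for its cellular embeddings
in closed orientable surfaces, up to orientation-preserving equivalence. -/
structure RotationSystem where
  next : Equiv.Perm G.Dart
  fst_next : ∀ d : G.Dart, (next d).fst = d.fst
  sameCycle_of_fst_eq : ∀ d e : G.Dart, d.fst = e.fst → next.SameCycle d e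

variable {G} in
/-- The face-tracing permutation: run along a dart to the other end of its edge, then go to the next
edge-end in the rotation there. Its orbits are the boundary walks of the faces. -/
def RotationSystem.facePerm (R : G.RotationSystem) : Equiv.Perm G.Dart :=
  (SimpleGraph.Dart.symm_involutive (G := G)).toPerm.trans R.next

variable {G} in
/-- The number of faces of an embedded connected finite graph. The `max` only matters for the graph
with one vertex and no edge: its embedding in the sphere has one face, but there is no dart. -/
noncomputable def RotationSystem.numFaces (R : G.RotationSystem) : ℕ :=
  max 1 (Nat.card (Quotient (Equiv.Perm.SameCycle.setoid R.facePerm)))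

/-- `G` has a cellular embedding in the closed orientable surface `S_k` of genus `k`: it is connected
and some rotation system satisfies the Euler equation `|V| - |E| + |F| = 2 - 2k`. -/
def CellularEmbedsIn (k : ℕ) : Prop :=
  G.Connected ∧ ∃ R : G.RotationSystem,
    (Nat.card V : ℤ) - (Nat.card G.edgeSet : ℤ) + (R.numFaces : ℤ) = 2 - 2 * (k : ℤ)

/-- The minimum genus `γ(G)` of a connected finite graph. -/
noncomputable def minGenus : ℕ := sInf {k : ℕ | G.CellularEmbedsIn k}

/-- The maximum genus `Γ(G)` of a connected finite graph. -/
noncomputable def maxGenus : ℕ := sSup {k : ℕ | G.CellularEmbedsIn k}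

/-- `G` is upper-embeddable: it has a cellular embedding with one or two faces. -/
def UpperEmbeddable : Prop :=
  G.Connected ∧ ∃ R : G.RotationSystem, R.numFaces = 1 ∨ R.numFaces = 2

/-- Adjacency in the scaffolded graph. The vertices `Sum.inr (i, _)` are the five vertices of the
`i`-th copy of `H₃` other than its free nodes: a `K_{3,2}` whose three 2-valent vertices
`Sum.inl 0, Sum.inl 1, Sum.inl 2` carry the pendant (free) edges. -/
def scaffoldAdj {ι : Type*} (T : ι → Fin 3 → V) :
    V ⊕ (ι × (Fin 3 ⊕ Fin 2)) → V ⊕ (ι × (Fin 3 ⊕ Fin 2)) → Prop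
  | Sum.inl u, Sum.inl v => G.Adj u v
  | Sum.inl u, Sum.inr (i, Sum.inl j) => u = T i j
  | Sum.inr (i, Sum.inl j), Sum.inl u => u = T i j
  | Sum.inl _, Sum.inr (_, Sum.inr _) => False
  | Sum.inr (_, Sum.inr _), Sum.inl _ => False
  | Sum.inr (i, x), Sum.inr (i', y) => i = i' ∧ (completeBipartiteGraph (Fin 3) (Fin 2)).Adj x y

/-- The scaffolded graph `H(G, T)`: for every `i`, a new copy of `H₃` (a `K_{2,3}` with a pendant
vertex, the free node, attached to each 2-valent vertex) has its three free nodes identified with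
`T i 0, T i 1, T i 2`. -/
def scaffold {ι : Type*} (T : ι → Fin 3 → V) : SimpleGraph (V ⊕ (ι × (Fin 3 ⊕ Fin 2))) where
  Adj := G.scaffoldAdj T
  symm := ⟨by
    rintro (u | ⟨i, j | h⟩) (v | ⟨i', j' | h'⟩) huv
    all_goals
      first
        | exact huv.elim
        | exact G.adj_symm huv
        | exact huv
        | exact ⟨huv.1.symm, huv.2.symm⟩⟩
  loopless := ⟨by
    rintro (u | ⟨i, j | h⟩) huv <;> simp [scaffoldAdj] at huv⟩

end SimpleGraph

/-- `G₄`: the cycle `d₀ a₀ a₁ a₂ d₁ d₂ b₀ b₁ b₂ d₃ c₀ c₁ c₂` (numbered `0, …, 12` in this order)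
with the two crossing chords `d₀d₂` and `d₁d₃`. -/
def graphG4 : SimpleGraph (Fin 13) :=
  SimpleGraph.cycleGraph 13 ⊔ SimpleGraph.fromEdgeSet {s(0, 5), s(4, 9)}

/-- The triples `{aᵢ, bᵢ, cᵢ}`, `i = 0, 1, 2`, in `G₄`. -/
def triplesG4 : Fin 3 → Fin 3 → Fin 13 :=
  ![![1, 6, 10], ![2, 7, 11], ![3, 8, 12]]

/-- `G₅`: the cycle `a₀ … a₄ b₀ … b₄ c₀ … c₄` (numbered `0, …, 14` in this order) with the
chord `a₀b₀`. -/
def graphG5 : SimpleGraph (Fin 15) :=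
  SimpleGraph.cycleGraph 15 ⊔ SimpleGraph.fromEdgeSet {s(0, 5)}

/-- The triples `{aᵢ, bᵢ, cᵢ}`, `i = 1, 2, 3, 4`, in `G₅`. -/
def triplesG5 : Fin 4 → Fin 3 → Fin 15 :=
  ![![1, 6, 11], ![2, 7, 12], ![3, 8, 13], ![4, 9, 14]]

/-- `G₆`: the cycle `a₀ … a₄ b₀ … b₄ c₀ … c₄` (numbered `0, …, 14` in this order). -/
def graphG6 : SimpleGraph (Fin 15) := SimpleGraph.cycleGraph 15

/-- The triples `{aᵢ, bᵢ, cᵢ}`, `i = 0, 1, 2, 3, 4`, in `G₆`. -/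
def triplesG6 : Fin 5 → Fin 3 → Fin 15 :=
  ![![0, 5, 10], ![1, 6, 11], ![2, 7, 12], ![3, 8, 13], ![4, 9, 14]]

/-- Milgram's graph `M₄`. -/
def graphM4 : SimpleGraph (Fin 13 ⊕ (Fin 3 × (Fin 3 ⊕ Fin 2))) := graphG4.scaffold triplesG4

/-- The graph `M₅`. -/
def graphM5 : SimpleGraph (Fin 15 ⊕ (Fin 4 × (Fin 3 ⊕ Fin 2))) := graphG5.scaffold triplesG5

/-- The graph `M₆`. -/
def graphM6 : SimpleGraph (Fin 15 ⊕ (Fin 5 × (Fin 3 ⊕ Fin 2))) := graphG6.scaffold triplesG6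

/-! By the Euler equation every genus statement is a statement about numbers of faces, and the
parity of the number of faces is fixed by the graph. The maximum genus therefore follows from one
rotation system with one or two faces. The minimum genus follows from one with 8, 9 or 10 faces
together with the upper bounds 9, 10 and 11 for `graphM4`, `graphM5` and `graphM6`; parity closes
the remaining gap.

For the upper bound, view each graph as a cycle of 15 vertices, some possibly mere subdivision
points, in five blocks of three equally spaced vertices. Each block carries a copy of `H₃` or a
chord. A rotation system chooses a side of the cycle for each attached edge, and face tracing
through the attachment of block `i` that enters at `j` leaves at `τ i j`. Thus the faces meeting the
cycle are counted by the cycles of `blockPerm s τ * facePerm`, where `facePerm` belongs to the bare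
cycle and has at most two cycles. Multiplication by a transposition adds at most one cycle, and none
if it joins different cycles. A copy of `H₃` contains at most one inner face, and only when `τ i` is
odd (`exists_perm_gadgetStep`), so a block gains at most 2 faces, and a chord only 1. This gives 12
minus the number of chords.

One more face is lost (`numCycles_blockPerm_mul_le`): if all `τ i` are nontrivial, split off a
transposition from each. Either one of them joins the two sides of the cycle, or three lie on one
side and two of these cross; in both cases a transposition joins different cycles. If some `τ i` is
trivial, its block gains nothing. Hence the bound 11 in `CycleVertex.card_add_card_le`. -/

/-! ### Cycle counts under multiplication by transpositions -/

namespace Equiv.Perm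

/-- The number of cycles of a permutation, fixed points included. -/
noncomputable def numCycles {α : Type*} (f : Perm α) : ℕ :=
  Nat.card (Quotient (SameCycle.setoid f))

variable {α : Type*}

theorem sameCycle_setoid_le (f : Perm α) (r : Setoid α) (h : ∀ a, r (f a) a) :
    SameCycle.setoid f ≤ r := by
  intro a b hab
  obtain ⟨n, rfl⟩ : SameCycle f a b := hab
  apply Setoid.symm' (r := r)
  have key : ∀ (n : ℤ) (a : α), r ((f ^ n) a) a := by
    intro n
    induction n with
    | zero => intro a; exact Setoid.refl' r a
    | succ n ih =>
      intro a
      rw [zpow_add_one, mul_apply]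
      exact Setoid.trans' r (ih _) (h a)
    | pred n ih =>
      intro a
      rw [zpow_sub_one, mul_apply]
      refine Setoid.trans' r (ih _) (Setoid.symm' r ?_)
      have := h (f⁻¹ a)
      rwa [← mul_apply, mul_inv_cancel, one_apply] at this
  exact key n a

theorem SameCycle.apply_eq {β : Type*} {f : Perm α} {a b : α} (hab : SameCycle f a b)
    (g : α → β) (hg : ∀ a, g (f a) = g a) : g a = g b :=
  sameCycle_setoid_le f (Setoid.ker g) hg hab

/-- The setoid generated by the cycles of `f` and by one more pair `x`, `y`. -/
def joinSetoid (f : Perm α) (x y : α) : Setoid α :=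
  SameCycle.setoid f ⊔ Relation.EqvGen.setoid (fun a b => a = x ∧ b = y)

theorem joinSetoid_swap_mul_le [DecidableEq α] (f : Perm α) (x y : α) :
    joinSetoid (swap x y * f) x y ≤ joinSetoid f x y := by
  refine sup_le (sameCycle_setoid_le _ _ fun a => ?_) le_sup_right
  have hxy : (joinSetoid f x y) x y :=
    (le_sup_right : _ ≤ joinSetoid f x y) (Relation.EqvGen.rel _ _ ⟨rfl, rfl⟩)
  have hs : ∀ a, (joinSetoid f x y) (swap x y a) a := by
    intro a
    by_cases hx : a = x
    · subst hx; rw [swap_apply_left]; exact Setoid.symm' _ hxy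
    by_cases hy : a = y
    · subst hy; rw [swap_apply_right]; exact hxy
    rw [swap_apply_of_ne_of_ne hx hy]
  exact Setoid.trans' _ (hs (f a)) ((le_sup_left : SameCycle.setoid f ≤ joinSetoid f x y)
      (show SameCycle f (f a) a from sameCycle_apply_left.mpr (SameCycle.refl _ _)))

/-- Once `x` and `y` are identified, the transposition is invisible; as it is an involution, one
inclusion gives both. -/
theorem joinSetoid_swap_mul [DecidableEq α] (f : Perm α) (x y : α) :
    joinSetoid (swap x y * f) x y = joinSetoid f x y :=
  le_antisymm (joinSetoid_swap_mul_le f x y) (by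
    simpa [← mul_assoc] using joinSetoid_swap_mul_le (swap x y * f) x y)

theorem joinSetoid_iff (f : Perm α) (x y a b : α) : joinSetoid f x y a b ↔
    SameCycle f a b ∨
      ((SameCycle f a x ∨ SameCycle f a y) ∧ (SameCycle f b x ∨ SameCycle f b y)) := by
  constructor
  · intro h
    let r : Setoid α :=
      { r := fun a b => SameCycle f a b ∨
          ((SameCycle f a x ∨ SameCycle f a y) ∧ (SameCycle f b x ∨ SameCycle f b y))
        iseqv :=
          ⟨fun a => .inl (SameCycle.refl _ _), fun {a b} h => by
            rcases h with h | ⟨h, h'⟩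
            · exact .inl h.symm
            · exact .inr ⟨h', h⟩, fun {a b c} h h' => by
            rcases h with h | ⟨h1, h2⟩ <;> rcases h' with h' | ⟨h3, h4⟩
            · exact .inl (h.trans h')
            · exact .inr ⟨h3.imp h.trans h.trans, h4⟩
            · exact .inr ⟨h1, h2.imp h'.symm.trans h'.symm.trans⟩
            · exact .inr ⟨h1, h4⟩⟩ }
    have : joinSetoid f x y ≤ r := by
      refine sup_le (fun a b h => .inl h) (Setoid.eqvGen_le ?_)
      rintro a b ⟨rfl, rfl⟩
      exact .inr ⟨.inl (SameCycle.refl _ _), .inr (SameCycle.refl _ _)⟩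
    exact this h
  · intro h
    have hxy : (joinSetoid f x y) x y :=
      (le_sup_right : _ ≤ joinSetoid f x y) (Relation.EqvGen.rel _ _ ⟨rfl, rfl⟩)
    have hl : ∀ {a b}, SameCycle f a b → joinSetoid f x y a b := fun {a b} h =>
      (le_sup_left : SameCycle.setoid f ≤ joinSetoid f x y) h
    have hx : ∀ {a}, (SameCycle f a x ∨ SameCycle f a y) → joinSetoid f x y a x := by
      rintro a (h | h)
      · exact hl h
      · exact Setoid.trans' _ (hl h) (Setoid.symm' _ hxy)
    rcases h with h | ⟨h, h'⟩
    · exact hl h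
    · exact Setoid.trans' _ (hx h) (Setoid.symm' _ (hx h'))

/-- Joining one pair merges at most two cycles: away from the cycle of `x`, which is sent to `none`,
the map to the coarser quotient is injective. -/
theorem numCycles_le_card_joinSetoid [Finite α] (f : Perm α) (x y : α) :
    f.numCycles ≤ Nat.card (Quotient (joinSetoid f x y)) + 1 := by
  classical
  let g : Quotient (SameCycle.setoid f) → Option (Quotient (joinSetoid f x y)) := fun q =>
    if q = ⟦x⟧ then none else some (Quotient.map id (fun a b h =>
      (le_sup_left : SameCycle.setoid f ≤ joinSetoid f x y) h) q)
  have hg : Function.Injective g := by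
    intro p q
    induction p using Quotient.ind with | _ a
    induction q using Quotient.ind with | _ b
    simp only [g]
    intro h
    by_cases ha : (⟦a⟧ : Quotient (SameCycle.setoid f)) = ⟦x⟧ <;>
      by_cases hb : (⟦b⟧ : Quotient (SameCycle.setoid f)) = ⟦x⟧
    · rw [ha, hb]
    · rw [if_pos ha, if_neg hb] at h; cases h
    · rw [if_neg ha, if_pos hb] at h; cases h
    · rw [if_neg ha, if_neg hb] at h
      have h' : joinSetoid f x y a b := Quotient.exact (Option.some.inj h)
      have ha' : ¬ SameCycle f a x := fun h => ha (Quotient.sound h)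
      have hb' : ¬ SameCycle f b x := fun h => hb (Quotient.sound h)
      rcases (joinSetoid_iff f x y a b).mp h' with h1 | ⟨h1, h2⟩
      · exact Quotient.sound h1
      · exact Quotient.sound ((h1.resolve_left ha').trans (h2.resolve_left hb').symm)
  calc f.numCycles ≤ Nat.card (Option (Quotient (joinSetoid f x y))) :=
        Nat.card_le_card_of_injective g hg
    _ = _ := Finite.card_option

theorem card_joinSetoid_le_numCycles [Finite α] (f : Perm α) (x y : α) :
    Nat.card (Quotient (joinSetoid f x y)) ≤ f.numCycles :=
  Nat.card_le_card_of_surjective (Quotient.map id (fun _ _ h =>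
      (le_sup_left : SameCycle.setoid f ≤ joinSetoid f x y) h))
    (by rintro ⟨a⟩; exact ⟨⟦a⟧, rfl⟩)

theorem card_joinSetoid_lt_numCycles [Finite α] (f : Perm α) {x y : α} (h : ¬ SameCycle f x y) :
    Nat.card (Quotient (joinSetoid f x y)) < f.numCycles := by
  classical
  have hle : SameCycle.setoid f ≤ joinSetoid f x y := le_sup_left
  refine lt_of_le_of_ne (card_joinSetoid_le_numCycles f x y) fun heq => h ?_
  have hs : Function.Surjective (Quotient.map id (fun _ _ h => hle h) :
      Quotient (SameCycle.setoid f) → Quotient (joinSetoid f x y)) := by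
    rintro ⟨a⟩; exact ⟨⟦a⟧, rfl⟩
  have hb := hs.bijective_of_nat_card_le heq.ge
  refine Quotient.exact (hb.1 (a₁ := ⟦x⟧) (a₂ := ⟦y⟧) ?_)
  exact Quotient.sound ((le_sup_right : _ ≤ joinSetoid f x y)
    (Relation.EqvGen.rel _ _ ⟨rfl, rfl⟩))

/-- Both permutations have the same joined quotient, and the number of cycles of each exceeds its
size by at most one. -/
theorem numCycles_swap_mul_le [Finite α] [DecidableEq α] (f : Perm α) (x y : α) :
    (swap x y * f).numCycles ≤ f.numCycles + 1 := by
  have h1 := numCycles_le_card_joinSetoid (swap x y * f) x y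
  rw [joinSetoid_swap_mul] at h1
  have h2 := card_joinSetoid_le_numCycles f x y
  omega

/-- Here `f` already has more cycles than the joined quotient has classes, so the possible gain of
one is absorbed. -/
theorem numCycles_swap_mul_le_of_not_sameCycle [Finite α] [DecidableEq α] (f : Perm α) {x y : α}
    (h : ¬ SameCycle f x y) : (swap x y * f).numCycles ≤ f.numCycles := by
  have h1 := numCycles_le_card_joinSetoid (swap x y * f) x y
  rw [joinSetoid_swap_mul] at h1
  have h2 := card_joinSetoid_lt_numCycles f h
  omega

/-- Multiplication by `g` on the left adds at most `k` cycles. -/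
def AddsAtMost (k : ℕ) (g : Perm α) : Prop :=
  ∀ f : Perm α, (g * f).numCycles ≤ f.numCycles + k

theorem AddsAtMost.one : AddsAtMost 0 (1 : Perm α) := fun f => by simp

theorem AddsAtMost.mul {k l : ℕ} {g h : Perm α} (hg : AddsAtMost k g) (hh : AddsAtMost l h) :
    AddsAtMost (k + l) (g * h) := fun f => by
  have := hg (h * f)
  have := hh f
  rw [mul_assoc]
  omega

theorem addsAtMost_swap [Finite α] [DecidableEq α] (x y : α) : AddsAtMost 1 (swap x y) :=
  fun f => numCycles_swap_mul_le f x y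

end Equiv.Perm

/-! ### The 15-cycle with five attached blocks -/

open Equiv Equiv.Perm

/-- The vertices `a₀, …, a₄, b₀, …, b₄, c₀, …, c₄` of a cycle of length `15`. The pair `(i, j)` is
the vertex number `i + 5 * j`, which belongs to the `i`-th of five blocks. -/
abbrev CycleVertex := Fin 5 × Fin 3

namespace CycleVertex

/-- The next vertex of the cycle. -/
def succ (v : CycleVertex) : CycleVertex := (v.1 + 1, if v.1 = 4 then v.2 + 1 else v.2)

/-- The previous vertex of the cycle. -/
def pred (v : CycleVertex) : CycleVertex := (v.1 - 1, if v.1 = 0 then v.2 - 1 else v.2)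

theorem pred_succ : ∀ v : CycleVertex, pred (succ v) = v := by decide

theorem succ_pred : ∀ v : CycleVertex, succ (pred v) = v := by decide

/-- The face permutation of the cycle embedded in the sphere. The element `(v, true)` is the dart
from `v` to its successor and `(v, false)` is the dart from `v` to its predecessor. -/
def facePerm : Perm (CycleVertex × Bool) where
  toFun x := (cond x.2 (succ x.1) (pred x.1), x.2)
  invFun x := (cond x.2 (pred x.1) (succ x.1), x.2)
  left_inv := by rintro ⟨v, _ | _⟩ <;> simp [pred_succ, succ_pred]
  right_inv := by rintro ⟨v, _ | _⟩ <;> simp [pred_succ, succ_pred]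

theorem numCycles_facePerm_le : facePerm.numCycles ≤ 2 := by
  have hreach : ∀ x : CycleVertex × Bool, ∃ n : Fin 15, (facePerm ^ (n : ℕ)) ((0, 0), x.2) = x := by
    decide +kernel
  calc facePerm.numCycles ≤ Nat.card Bool := by
        refine Nat.card_le_card_of_surjective
          (fun b => (⟦((0, 0), b)⟧ : Quotient (SameCycle.setoid facePerm))) ?_
        rintro ⟨x⟩
        obtain ⟨n, hn⟩ := hreach x
        exact ⟨x.2, Quotient.sound (show SameCycle _ _ _ from ⟨n, by simpa using hn⟩)⟩
    _ = 2 := by simp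

/-- The product of permutations of the five blocks, as a permutation of the darts of the cycle; the
vertex `v` is represented by the dart `(v, s v)`. -/
noncomputable def blockPerm (s : CycleVertex → Bool) :
    (Fin 5 → Perm (Fin 3)) →* Perm (CycleVertex × Bool) :=
  (viaEmbeddingHom ⟨fun v : CycleVertex => (v, s v), fun v w h => (Prod.ext_iff.mp h).1⟩).comp
    { toFun := fun τ => Equiv.prodCongrRight τ
      map_one' := by ext1 x; rfl
      map_mul' := fun τ τ' => by ext1 x; rfl }

theorem blockPerm_apply (s : CycleVertex → Bool) (τ : Fin 5 → Perm (Fin 3)) (v : CycleVertex) :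
    blockPerm s τ (v, s v) = ((v.1, τ v.1 v.2), s (v.1, τ v.1 v.2)) :=
  viaEmbedding_apply _ ⟨fun v : CycleVertex => (v, s v), fun _ _ h => (Prod.ext_iff.mp h).1⟩ v

theorem blockPerm_apply_of_ne (s : CycleVertex → Bool) (τ : Fin 5 → Perm (Fin 3)) {v : CycleVertex}
    {b : Bool} (h : b ≠ s v) : blockPerm s τ (v, b) = (v, b) := by
  refine viaEmbedding_apply_of_notMem _ _ _ ?_
  rintro ⟨w, hw⟩
  obtain ⟨rfl, rfl⟩ := Prod.ext_iff.mp hw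
  exact h rfl

theorem blockPerm_mulSingle_swap (s : CycleVertex → Bool) (i : Fin 5) (p q : Fin 3) :
    blockPerm s (Pi.mulSingle i (swap p q)) = swap ((i, p), s (i, p)) ((i, q), s (i, q)) := by
  ext1 ⟨⟨i', j⟩, b⟩
  by_cases hb : b = s (i', j)
  · subst hb
    rw [blockPerm_apply]
    by_cases hi : i' = i
    · subst hi
      simp only [Pi.mulSingle_eq_same]
      by_cases hp : j = p
      · subst hp; simp
      by_cases hq : j = q
      · subst hq; simp
      rw [swap_apply_of_ne_of_ne hp hq, swap_apply_of_ne_of_ne] <;> simp [hp, hq]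
    · rw [swap_apply_of_ne_of_ne] <;> simp [hi]
  · rw [blockPerm_apply_of_ne s _ hb, swap_apply_of_ne_of_ne]
    · rintro h; simp only [Prod.mk.injEq] at h; obtain ⟨⟨rfl, rfl⟩, rfl⟩ := h; exact hb rfl
    · rintro h; simp only [Prod.mk.injEq] at h; obtain ⟨⟨rfl, rfl⟩, rfl⟩ := h; exact hb rfl

/-- The least number of transpositions with product `σ`. -/
def swapLength (σ : Perm (Fin 3)) : ℕ := if σ = 1 then 0 else if sign σ = -1 then 1 else 2

/-- Modulo 3 the pairs `k`, `k + 1` run through all transpositions. This cyclic form makes every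
chord cut off an arc of five edges. -/
theorem exists_eq_mul_swap : ∀ σ : Perm (Fin 3), σ ≠ 1 → ∃ k : Fin 3,
    swapLength (σ * swap k (k + 1)) + 1 = swapLength σ := by decide +kernel

theorem addsAtMost_mulSingle (s : CycleVertex → Bool) (i : Fin 5) (σ : Perm (Fin 3)) :
    AddsAtMost (swapLength σ) (blockPerm s (Pi.mulSingle i σ)) := by
  induction h : swapLength σ generalizing σ with
  | zero =>
    have : σ = 1 := by revert σ; decide +kernel
    subst this
    simpa using AddsAtMost.one
  | succ n ih =>
    obtain ⟨k, hk⟩ := exists_eq_mul_swap σ (by rintro rfl; simp [swapLength] at h)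
    have h1 := (ih (σ * swap k (k + 1)) (by omega)).mul
      (addsAtMost_swap ((i, k), s (i, k)) ((i, k + 1), s (i, k + 1)))
    rw [← blockPerm_mulSingle_swap, ← map_mul, ← Pi.mulSingle_mul, mul_assoc, swap_mul_self,
      mul_one] at h1
    exact h1

theorem addsAtMost_blockPerm (s : CycleVertex → Bool) (τ : Fin 5 → Perm (Fin 3)) :
    AddsAtMost (∑ i, swapLength (τ i)) (blockPerm s τ) := by
  have hτ : τ = Pi.mulSingle 0 (τ 0) * Pi.mulSingle 1 (τ 1) * Pi.mulSingle 2 (τ 2) *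
      Pi.mulSingle 3 (τ 3) * Pi.mulSingle 4 (τ 4) := by
    ext1 i; fin_cases i <;> simp
  rw [Fin.sum_univ_five]
  conv_rhs => rw [hτ]
  simp only [map_mul]
  exact ((((addsAtMost_mulSingle s 0 _).mul (addsAtMost_mulSingle s 1 _)).mul
    (addsAtMost_mulSingle s 2 _)).mul (addsAtMost_mulSingle s 3 _)).mul (addsAtMost_mulSingle s 4 _)

/-- The darts on the side `b` of the cycle that lie in the face cut off by the chord from `(i, k)` to
`(i, k + 1)`, namely the face that does not reach the third vertex of the block. -/
def arc (i : Fin 5) (k : Fin 3) (b : Bool) (x : CycleVertex × Bool) : Bool :=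
  let d := (x.1.1.val + 5 * x.1.2.val + 15 - (i.val + 5 * k.val)) % 15
  x.2 == b && cond b (d < 5) (0 < d && d ≤ 5)

/-- The arc is a union of cycles after the first chord is drawn, so it is an invariant that
separates faces. -/
theorem arc_swap_mul_facePerm : ∀ i k b x,
    arc i k b ((swap ((i, k), b) ((i, k + 1), b) * facePerm) x) = arc i k b x := by
  decide +kernel

/-- The arc from `(i, k)` to `(i, k + 1)` meets block `j` only in `(j, k)`. The second chord has
this vertex as an end, and so crosses the first, unless `l = k + 1`. -/
theorem arc_ne_arc : ∀ i j : Fin 5, i < j → ∀ k l : Fin 3, l ≠ k + 1 → ∀ b,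
    arc i k b ((j, l), b) ≠ arc i k b ((j, l + 1), b) := by
  decide +kernel

/-- The first chord may split a face, but a chord crossing it has its ends in different faces and
adds none. -/
theorem numCycles_crossing_swaps_le {i j : Fin 5} (hij : i < j) {k l : Fin 3} (hkl : l ≠ k + 1)
    (b : Bool) : (swap ((j, l), b) ((j, l + 1), b) * (swap ((i, k), b) ((i, k + 1), b) *
      facePerm)).numCycles ≤ 3 := by
  have h1 := numCycles_swap_mul_le_of_not_sameCycle
    (swap ((i, k), b) ((i, k + 1), b) * facePerm) (x := ((j, l), b)) (y := ((j, l + 1), b))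
    fun h => arc_ne_arc i j hij k l hkl b (h.apply_eq _ (arc_swap_mul_facePerm i k b))
  have h2 := numCycles_swap_mul_le facePerm ((i, k), b) ((i, k + 1), b)
  have h3 := numCycles_facePerm_le
  omega

/-- The side is invariant under `facePerm`, so the transposition joins two different faces of the
cycle. -/
theorem numCycles_swap_ne_le (v w : CycleVertex) {b c : Bool} (hbc : b ≠ c) :
    (swap (v, b) (w, c) * facePerm).numCycles ≤ 2 :=
  (numCycles_swap_mul_le_of_not_sameCycle _ fun h =>
    hbc (h.apply_eq Prod.snd fun _ => rfl)).trans numCycles_facePerm_le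

theorem exists_three_eq : ∀ b : Fin 5 → Bool, ∃ i j l, i < j ∧ j < l ∧ b i = b j ∧ b i = b l := by
  decide +kernel

/-- Five nontrivial blocks cannot all be drawn in the two sides of the cycle. -/
theorem numCycles_blockPerm_mul_le (s : CycleVertex → Bool) (τ : Fin 5 → Perm (Fin 3))
    (hτ : ∀ i, τ i ≠ 1) :
    (blockPerm s τ * facePerm).numCycles ≤ 1 + ∑ i, swapLength (τ i) := by
  choose k hk using fun i => exists_eq_mul_swap (τ i) (hτ i)
  set t : Fin 5 → Perm (Fin 3) := fun i => swap (k i) (k i + 1)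
  have hsingle : ∀ i, blockPerm s (Pi.mulSingle i (t i)) =
      swap ((i, k i), s (i, k i)) ((i, k i + 1), s (i, k i + 1)) := fun i =>
    blockPerm_mulSingle_swap s i _ _
  by_cases hs : ∀ i, s (i, k i) = s (i, k i + 1)
  -- All five chords stay on one side each, so three share a side. If the first of the three crosses
  -- neither of the others, those two start at the same index and cross each other.
  · obtain ⟨i, j, hij, hkl, hb⟩ : ∃ i j : Fin 5, i < j ∧ k j ≠ k i + 1 ∧
        s (i, k i) = s (j, k j) := by
      obtain ⟨i, j, l, hij, hjl, h1, h2⟩ := exists_three_eq fun i => s (i, k i)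
      by_cases h3 : k j = k i + 1
      · by_cases h4 : k l = k i + 1
        · refine ⟨j, l, hjl, ?_, h1.symm.trans h2⟩
          rw [h3, h4]
          generalize k i = m
          revert m; decide
        · exact ⟨i, l, hij.trans hjl, h4, h2⟩
      · exact ⟨i, j, hij, h3, h1⟩
    -- Apply the two crossing transpositions first, for at most 3 cycles; what remains has length
    -- two less.
    set ρ : Fin 5 → Perm (Fin 3) := fun m => if m = i ∨ m = j then τ m * t m else τ m
    have hρ : τ = ρ * Pi.mulSingle j (t j) * Pi.mulSingle i (t i) := by
      ext1 m
      by_cases hmi : m = i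
      · subst hmi; simp [ρ, t, hij.ne, mul_assoc]
      · by_cases hmj : m = j
        · subst hmj; simp [ρ, t, hij.ne', mul_assoc]
        · simp [ρ, hmi, hmj]
    have hlen : ∑ m, swapLength (ρ m) + 2 = ∑ m, swapLength (τ m) := by
      have : ∀ m, swapLength (ρ m) + ((if m = i then 1 else 0) + (if m = j then 1 else 0)) =
          swapLength (τ m) := by
        intro m
        by_cases hmi : m = i
        · subst hmi; simpa [ρ, hij.ne] using hk m
        · by_cases hmj : m = j
          · subst hmj; simpa [ρ, hij.ne'] using hk m
          · simp [ρ, hmi, hmj]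
      rw [← Finset.sum_congr rfl fun m _ => this m]
      simp [Finset.sum_add_distrib]
    have h1 := addsAtMost_blockPerm s ρ (blockPerm s (Pi.mulSingle j (t j)) *
      (blockPerm s (Pi.mulSingle i (t i)) * facePerm))
    have h2 := numCycles_crossing_swaps_le hij hkl (s (i, k i))
    rw [hsingle, hsingle, ← hs i, ← hs j, ← hb] at h1
    rw [hρ, map_mul, map_mul, hsingle, hsingle, ← hs i, ← hs j, ← hb, mul_assoc, mul_assoc]
    rw [← hρ]
    omega
  -- Some chord runs between the two sides. Applied first, it leaves at most 2 cycles, and the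
  -- remaining length is one less.
  · push Not at hs
    obtain ⟨i, hi⟩ := hs
    have hρ : τ = Function.update τ i (τ i * t i) * Pi.mulSingle i (t i) := by
      ext1 m
      by_cases hmi : m = i
      · subst hmi; simp [t, mul_assoc]
      · simp [hmi]
    have hlen : ∑ m, swapLength (Function.update τ i (τ i * t i) m) + 1 =
        ∑ m, swapLength (τ m) := by
      have : ∀ m, swapLength (Function.update τ i (τ i * t i) m) + (if m = i then 1 else 0) =
          swapLength (τ m) := by
        intro m
        by_cases hmi : m = i
        · subst hmi; simpa using hk m
        · simp [hmi]
      rw [← Finset.sum_congr rfl fun m _ => this m]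
      simp [Finset.sum_add_distrib]
    have h1 := addsAtMost_blockPerm s (Function.update τ i (τ i * t i))
      (blockPerm s (Pi.mulSingle i (t i)) * facePerm)
    have h2 := numCycles_swap_ne_le (i, k i) (i, k i + 1) hi
    rw [hsingle] at h1
    rw [hρ, map_mul, hsingle, mul_assoc, ← hρ]
    omega

/-- A set `Q` of faces that arises from the two faces of the cycle by blocks, of which those in `B`
carry an additional face and those in `K` are chords. -/
theorem card_add_card_le {Q : Type*} (s : CycleVertex → Bool)
    (fwd bwd inp out : CycleVertex → Q)
    (hs : ∀ v, if s v then fwd v.pred = inp v ∧ out v = fwd v ∧ bwd v.succ = bwd v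
      else fwd v.pred = fwd v ∧ bwd v.succ = inp v ∧ out v = bwd v)
    (τ : Fin 5 → Perm (Fin 3)) (hτ : ∀ i j, inp (i, j) = out (i, τ i j))
    (K B : Finset (Fin 5)) (hKB : Disjoint K B) (e : Fin 5 → Q)
    (hsign : ∀ i ∈ K ∪ B, sign (τ i) = -1)
    (hcover : ∀ q, (∃ v, q = fwd v ∨ q = bwd v) ∨ ∃ i ∈ B, q = e i) :
    Nat.card Q + K.card ≤ 11 := by
  have hcyc : Nat.card Q ≤ (blockPerm s τ * facePerm).numCycles + B.card := by
    set P := blockPerm s τ * facePerm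
    -- Label each dart of the cycle by its face. The label is constant on the cycles of `P`, so
    -- these and the inner faces together map onto `Q`.
    let h : CycleVertex × Bool → Q := fun x => cond x.2 (fwd x.1) (bwd x.1)
    have hh : ∀ x, h (P x) = h x := by
      have hstep : ∀ x, h (blockPerm s τ x) =
          h (facePerm⁻¹ x) := by
        have hout : ∀ v, h (v, s v) = out v := by
          intro v
          have := hs v
          cases hv : s v <;> simp_all [h]
        have hinp : ∀ v, h (facePerm⁻¹ (v, s v)) = inp v := by
          intro v
          have := hs v
          cases hv : s v
          · rw [hv] at this
            exact this.2.1
          · rw [hv] at this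
            exact this.1
        rintro ⟨v, b⟩
        by_cases hb : b = s v
        · subst hb
          rw [blockPerm_apply, hout, hinp]
          exact (hτ v.1 v.2).symm
        · rw [blockPerm_apply_of_ne s τ hb]
          have h1 := hs v
          cases b
          · rw [if_pos (by simpa using hb)] at h1
            exact h1.2.2.symm
          · rw [if_neg (by simpa using hb)] at h1
            exact h1.1.symm
      intro x
      rw [mul_apply, hstep, ← mul_apply, inv_mul_cancel, one_apply]
    let g : Quotient (SameCycle.setoid P) ⊕ B → Q :=
      Sum.elim (Quotient.lift h fun a b hab => SameCycle.apply_eq hab h hh) (fun i => e i)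
    have hg : Function.Surjective g := by
      intro q
      rcases hcover q with ⟨v, rfl | rfl⟩ | ⟨i, hi, rfl⟩
      · exact ⟨.inl ⟦(v, true)⟧, rfl⟩
      · exact ⟨.inl ⟦(v, false)⟧, rfl⟩
      · exact ⟨.inr ⟨i, hi⟩, rfl⟩
    have := Nat.card_le_card_of_surjective g hg
    rwa [Nat.card_sum, Nat.card_eq_fintype_card (α := B), Fintype.card_coe] at this
  have hsum : ∀ c : Fin 5 → ℕ, (∀ i, swapLength (τ i) + (if i ∈ B then 1 else 0) +
      (if i ∈ K then 1 else 0) ≤ c i) → ∑ i, swapLength (τ i) + B.card + K.card ≤ ∑ i, c i := by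
    intro c hc
    refine le_of_eq_of_le ?_ (Finset.sum_le_sum fun i _ => hc i)
    simp [Finset.sum_add_distrib]
  -- An inner face or a chord forces `τ i` to be a transposition, of length 1, so the total is at
  -- most 2; without either, length 2 is the maximum.
  have hone : ∀ i, swapLength (τ i) + (if i ∈ B then 1 else 0) + (if i ∈ K then 1 else 0) ≤
      if τ i = 1 then 0 else 2 := by
    intro i
    by_cases hi : i ∈ K ∪ B
    · have h1 := hsign i hi
      have h2 : τ i ≠ 1 := by intro h; rw [h] at h1; simp at h1
      have h3 : ¬ (i ∈ K ∧ i ∈ B) := fun h => Finset.disjoint_left.mp hKB h.1 h.2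
      have h4 : swapLength (τ i) = 1 := by simp [swapLength, h1, h2]
      split_ifs <;> simp_all
    · rw [Finset.mem_union] at hi
      push Not at hi
      simp only [hi.1, hi.2, if_false, swapLength]
      split_ifs <;> simp
  have h3 := hsum _ hone
  by_cases hne : ∀ i, τ i ≠ 1
  · have h1 := numCycles_blockPerm_mul_le s τ hne
    simp only [hne, if_false, Finset.sum_const, Finset.card_univ, Fintype.card_fin,
      smul_eq_mul] at h3
    omega
  · push Not at hne
    obtain ⟨i, hi⟩ := hne
    have h1 := addsAtMost_blockPerm s τ facePerm
    have h2 := numCycles_facePerm_le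
    -- A trivial block saves 2, and the crude bound 2 + 8 already suffices.
    have h4 : ∑ i, (if τ i = 1 then 0 else 2) ≤ 8 := by
      rw [← Finset.add_sum_erase _ _ (Finset.mem_univ i), if_pos hi]
      refine (Nat.zero_add _).trans_le ((Finset.sum_le_card_nsmul _ _ 2 ?_).trans ?_)
      · intro m _; split_ifs <;> simp
      · simp
    omega

end CycleVertex

/-! ### Face tracing inside a copy of `H₃` -/

/-- The next dart on a face inside a copy of `H₃`. The elements `Sum.inl (j, k, true)` and
`Sum.inl (j, k, false)` are the two darts of the edge between the `j`-th vertex with a pendant edge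
and the `k`-th other vertex, the former starting at the `j`-th vertex; `Sum.inr j` is the dart that
leaves through the `j`-th pendant edge, where tracing stops. -/
def gadgetStep (σ : Fin 3 → Bool) (σ' : Fin 2 → Bool) :
    (Fin 3 × Fin 2 × Bool) ⊕ Fin 3 → (Fin 3 × Fin 2 × Bool) ⊕ Fin 3
  | .inr j => .inr j
  | .inl (j, k, true) => .inl (cond (σ' k) (j + 1) (j - 1), k, false)
  | .inl (j, k, false) =>
    if k = cond (σ j) 0 1 then .inl (j, cond (σ j) 1 0, true) else .inr j

set_option synthInstance.maxSize 2000 in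
/-- Face tracing through a copy of `H₃` connects its pendant edges by a permutation; a face inside
the copy exists at most if that permutation is a transposition, and there is at most one. -/
theorem exists_perm_gadgetStep : ∀ (σ : Fin 3 → Bool) (σ' : Fin 2 → Bool),
    ∃ (τ : Perm (Fin 3)) (b : Bool) (e : Fin 3 × Fin 2 × Bool),
      (∀ j, (gadgetStep σ σ')^[12] (.inl (j, cond (σ j) 0 1, true)) = .inr (τ j)) ∧
      (b = true → sign τ = -1) ∧
      ∀ d, (∃ j, (gadgetStep σ σ')^[12] (.inl d) = .inr j) ∨
        (b = true ∧ ∃ n : Fin 4, (gadgetStep σ σ')^[n] (.inl d) = .inl e) := by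
  decide +kernel

/-- The face label is invariant under `gadgetStep`, which transfers the finite check to arbitrary
labels. Twelve steps suffice to leave, as there are twelve inner darts. An inner face has only four
darts: each vertex with a pendant edge offers it one corner, each such corner switches between the
two other vertices, and so exactly two corners are used. -/
theorem exists_perm_of_gadget {Q : Type*} (inp out : Fin 3 → Q) (xy : Fin 3 → Fin 2 → Q)
    (yx : Fin 2 → Fin 3 → Q) (σ : Fin 3 → Bool) (σ' : Fin 2 → Bool)
    (hy : ∀ k j, xy j k = yx k (cond (σ' k) (j + 1) (j - 1)))
    (hx : ∀ j, if σ j then inp j = xy j 0 ∧ yx 0 j = xy j 1 ∧ yx 1 j = out j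
      else inp j = xy j 1 ∧ yx 1 j = xy j 0 ∧ yx 0 j = out j) :
    ∃ (τ : Perm (Fin 3)) (b : Bool) (e : Q), (∀ j, inp j = out (τ j)) ∧
      (b = true → sign τ = -1) ∧
      ∀ j k, ((∃ l, xy j k = out l) ∨ (b = true ∧ xy j k = e)) ∧
        ((∃ l, yx k j = out l) ∨ (b = true ∧ yx k j = e)) := by
  let h : (Fin 3 × Fin 2 × Bool) ⊕ Fin 3 → Q :=
    Sum.elim (fun d => cond d.2.2 (xy d.1 d.2.1) (yx d.2.1 d.1)) out
  have hstep : ∀ d, h (gadgetStep σ σ' d) = h d := by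
    rintro (⟨j, k, _ | _⟩ | j)
    · have h1 := hx j
      cases hj : σ j <;> fin_cases k <;> simp_all [gadgetStep, h]
    · exact (hy k j).symm
    · rfl
  have hiter : ∀ n d, h ((gadgetStep σ σ')^[n] d) = h d := by
    intro n
    induction n with
    | zero => simp
    | succ n ih => intro d; rw [Function.iterate_succ_apply, ih, hstep]
  obtain ⟨τ, b, e, h1, h2, h3⟩ := exists_perm_gadgetStep σ σ'
  have h4 : ∀ d, (∃ l, h (.inl d) = out l) ∨ (b = true ∧ h (.inl d) = h (.inl e)) := by
    intro d
    rcases h3 d with ⟨l, hl⟩ | ⟨hb, n, hn⟩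
    · exact .inl ⟨l, by rw [← hiter 12, hl]; rfl⟩
    · exact .inr ⟨hb, by rw [← hiter n, hn]⟩
  refine ⟨τ, b, h (.inl e), fun j => ?_, h2, fun j k => ⟨h4 (j, k, true), h4 (j, k, false)⟩⟩
  have h5 := hiter 12 (.inl (j, cond (σ j) 0 1, true))
  rw [h1] at h5
  have h6 := hx j
  cases hj : σ j <;> simp_all [h]

/-! ### From rotation systems to the bound on faces -/

namespace SimpleGraph

variable {V : Type*} {G : SimpleGraph V}

/-- The neighbours of `v` are the three distinct vertices `a`, `b`, `c`. -/
def HasNeighbors (G : SimpleGraph V) (v a b c : V) : Prop :=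
  (a ≠ b ∧ b ≠ c ∧ a ≠ c) ∧ ∀ z, G.Adj v z ↔ z = a ∨ z = b ∨ z = c

instance [Fintype V] [DecidableEq V] [DecidableRel G.Adj] (v a b c : V) :
    Decidable (G.HasNeighbors v a b c) :=
  inferInstanceAs (Decidable (_ ∧ _))

/-- A decomposition of a graph into a cycle, whose vertices are grouped in blocks of three, and
attachments of the blocks. The vertex `v` of the cycle lies between the darts `fwd v` and `bwd v`,
and its third neighbour is `third v`; the vertices outside `branch` are subdivision vertices. A
chord is attached to each block in `chords`, and a copy of `H₃` with vertices `x i j` and `y i k`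
to every other block `i`. -/
structure BlockData (V : Type*) where
  fwd : CycleVertex → V × V
  bwd : CycleVertex → V × V
  third : CycleVertex → V
  branch : Finset CycleVertex
  chords : Finset (Fin 5)
  x : Fin 5 → Fin 3 → V
  y : Fin 5 → Fin 2 → V

/-- `D` describes the graph `G`, except for its subdivision vertices. -/
def BlockData.Describes (D : BlockData V) (G : SimpleGraph V) : Prop :=
  (∀ v ∈ D.branch, (D.bwd v).1 = (D.fwd v).1 ∧ D.fwd v.pred = (D.bwd v).swap ∧
    D.bwd v.succ = (D.fwd v).swap ∧
    G.HasNeighbors (D.fwd v).1 (D.bwd v).2 (D.third v) (D.fwd v).2) ∧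
  (∀ i ∈ D.chords, (i, 0) ∈ D.branch ∧ (i, 1) ∈ D.branch ∧ (i, 2) ∉ D.branch ∧
    D.third (i, 0) = (D.fwd (i, 1)).1 ∧ D.third (i, 1) = (D.fwd (i, 0)).1) ∧
  (∀ i ∉ D.chords, (∀ j, (i, j) ∈ D.branch ∧ D.third (i, j) = D.x i j ∧
    G.HasNeighbors (D.x i j) (D.fwd (i, j)).1 (D.y i 0) (D.y i 1)) ∧
    ∀ k, G.HasNeighbors (D.y i k) (D.x i 0) (D.x i 1) (D.x i 2)) ∧
  ∀ u, (∃ v, v ∈ D.branch ∧ (D.fwd v).1 = u) ∨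
    (∃ i, i ∉ D.chords ∧ ((∃ j, D.x i j = u) ∨ ∃ k, D.y i k = u)) ∨
    ∃ v, ∀ w, G.Adj u w → D.fwd v = (u, w) ∨ D.bwd v = (u, w)

theorem BlockData.Describes.cover {D : BlockData V} (hD : D.Describes G) (u w : V)
    (huw : G.Adj u w) : (∃ v, (u, w) = D.fwd v ∨ (u, w) = D.bwd v) ∨
    (∃ v ∈ D.branch, (u, w) = ((D.fwd v).1, D.third v) ∨ (u, w) = (D.third v, (D.fwd v).1)) ∨
    ∃ i ∉ D.chords, ∃ j k, (u, w) = (D.x i j, D.y i k) ∨ (u, w) = (D.y i k, D.x i j) := by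
  obtain ⟨hS, -, hK', hcover⟩ := hD
  rcases hcover u with ⟨v, hv, rfl⟩ | ⟨i, hi, ⟨j, rfl⟩ | ⟨k, rfl⟩⟩ | ⟨v, hv⟩
  · obtain ⟨h1, -, -, h2⟩ := hS v hv
    rcases (h2.2 w).mp huw with rfl | rfl | rfl
    · exact .inl ⟨v, .inr (Prod.ext h1.symm rfl)⟩
    · exact .inr (.inl ⟨v, hv, .inl rfl⟩)
    · exact .inl ⟨v, .inl rfl⟩
  · obtain ⟨hb, ht, h2⟩ := (hK' i hi).1 j
    rcases (h2.2 w).mp huw with rfl | rfl | rfl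
    · exact .inr (.inl ⟨_, hb, .inr (by rw [ht])⟩)
    · exact .inr (.inr ⟨i, hi, j, 0, .inl rfl⟩)
    · exact .inr (.inr ⟨i, hi, j, 1, .inl rfl⟩)
  · rcases (((hK' i hi).2 k).2 w).mp huw with rfl | rfl | rfl
    · exact .inr (.inr ⟨i, hi, 0, k, .inr rfl⟩)
    · exact .inr (.inr ⟨i, hi, 1, k, .inr rfl⟩)
    · exact .inr (.inr ⟨i, hi, 2, k, .inr rfl⟩)
  · exact .inl ⟨v, (hv w huw).imp Eq.symm Eq.symm⟩

set_option synthInstance.maxSize 2000 in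
instance [Fintype V] [DecidableEq V] [DecidableRel G.Adj] (D : BlockData V) :
    Decidable (D.Describes G) :=
  inferInstanceAs (Decidable (_ ∧ _))

namespace RotationSystem

/-- The faces of an embedded graph. -/
abbrev Face (R : G.RotationSystem) : Type _ := Quotient (SameCycle.setoid R.facePerm)

open Classical in
/-- The face whose boundary contains the dart from `u` to `v`. -/
noncomputable def face [Nonempty G.Dart] (R : G.RotationSystem) (u v : V) : R.Face :=
  if h : G.Adj u v then ⟦⟨(u, v), h⟩⟧ else ⟦Classical.arbitrary _⟧

variable [Nonempty G.Dart] (R : G.RotationSystem)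

/-- This is the rotation at `v` read on neighbours. Its transitivity is needed only in the form that
there is no fixed point when `v` has another neighbour. -/
theorem exists_next (v : V) : ∃ N : V → V,
    (∀ u, G.Adj v u → G.Adj v (N u) ∧ R.face u v = R.face v (N u)) ∧
    (∀ u w, G.Adj v u → G.Adj v w → N u = N w → u = w) ∧
    ∀ u w, G.Adj v u → G.Adj v w → u ≠ w → N u ≠ u := by
  classical
  have hfst : ∀ u (h : G.Adj v u), (R.next ⟨(v, u), h⟩).fst = v := fun u h => R.fst_next _
  refine ⟨fun u => if h : G.Adj v u then (R.next ⟨(v, u), h⟩).snd else u, ?_, ?_, ?_⟩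
  · intro u h
    have hadj : G.Adj v (R.next ⟨(v, u), h⟩).snd := by
      have := (R.next ⟨(v, u), h⟩).adj
      rwa [show (R.next ⟨(v, u), h⟩).toProd.1 = v from hfst u h] at this
    simp only [dif_pos h]
    refine ⟨hadj, ?_⟩
    rw [face, face, dif_pos h.symm, dif_pos hadj]
    apply Quotient.sound
    have h1 : R.facePerm ⟨(u, v), h.symm⟩ = ⟨(v, (R.next ⟨(v, u), h⟩).snd), hadj⟩ := by
      refine SimpleGraph.Dart.ext _ _ (Prod.ext (hfst u h) rfl)
    show SameCycle _ _ _
    rw [← h1]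
    exact sameCycle_apply_right.mpr (SameCycle.refl _ _)
  · intro u w hu hw h
    simp only [dif_pos hu, dif_pos hw] at h
    have h1 : R.next ⟨(v, u), hu⟩ = R.next ⟨(v, w), hw⟩ :=
      SimpleGraph.Dart.ext _ _ (Prod.ext ((hfst u hu).trans (hfst w hw).symm) h)
    have h2 := R.next.injective h1
    simpa using h2
  · intro u w hu hw huw h
    simp only [dif_pos hu] at h
    have h1 : R.next ⟨(v, u), hu⟩ = ⟨(v, u), hu⟩ :=
      SimpleGraph.Dart.ext _ _ (Prod.ext (hfst u hu) h)
    obtain ⟨n, hn⟩ := R.sameCycle_of_fst_eq ⟨(v, u), hu⟩ ⟨(v, w), hw⟩ rfl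
    rw [zpow_apply_eq_self_of_apply_eq_self h1] at hn
    apply huw
    simpa using hn

theorem face_of_two_neighbors {v a b : V} (hab : a ≠ b) (h : ∀ z, G.Adj v z ↔ z = a ∨ z = b) :
    R.face a v = R.face v b ∧ R.face b v = R.face v a := by
  obtain ⟨N, h1, -, h3⟩ := R.exists_next v
  have ha := (h a).mpr (.inl rfl)
  have hb := (h b).mpr (.inr rfl)
  have h4 := ((h _).mp (h1 a ha).1).resolve_left (h3 a b ha hb hab)
  have h5 := ((h _).mp (h1 b hb).1).resolve_right (h3 b a hb ha hab.symm)
  exact ⟨h4 ▸ (h1 a ha).2, h5 ▸ (h1 b hb).2⟩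

/-- An injective map without fixed points on three elements is one of the two 3-cycles. -/
theorem exists_face_of_hasNeighbors {v a b c : V} (h : G.HasNeighbors v a b c) : ∃ s : Bool,
    if s then R.face a v = R.face v b ∧ R.face b v = R.face v c ∧ R.face c v = R.face v a
    else R.face a v = R.face v c ∧ R.face b v = R.face v a ∧ R.face c v = R.face v b := by
  obtain ⟨N, h1, h2, h3⟩ := R.exists_next v
  obtain ⟨⟨hab, hbc, hac⟩, h⟩ := h
  have ha := (h a).mpr (.inl rfl)
  have hb := (h b).mpr (.inr (.inl rfl))
  have hc := (h c).mpr (.inr (.inr rfl))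
  have ka := (h _).mp (h1 a ha).1
  have kb := (h _).mp (h1 b hb).1
  have kc := (h _).mp (h1 c hc).1
  have fa := (h1 a ha).2
  have fb := (h1 b hb).2
  have fc := (h1 c hc).2
  have na := h3 a b ha hb hab
  have nb := h3 b a hb ha hab.symm
  have nc := h3 c a hc ha hac.symm
  have iab := h2 a b ha hb
  have iac := h2 a c ha hc
  have ibc := h2 b c hb hc
  rcases ka with ka | ka | ka <;> rcases kb with kb | kb | kb <;> rcases kc with kc | kc | kc <;>
    first
      | exact absurd ka na
      | exact absurd kb nb
      | exact absurd kc nc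
      | exact absurd (iab (ka.trans kb.symm)) hab
      | exact absurd (iac (ka.trans kc.symm)) hac
      | exact absurd (ibc (kb.trans kc.symm)) hbc
      | exact ⟨true, by rw [ka] at fa; rw [kb] at fb; rw [kc] at fc; exact ⟨fa, fb, fc⟩⟩
      | exact ⟨false, by rw [ka] at fa; rw [kb] at fb; rw [kc] at fc; exact ⟨fa, fb, fc⟩⟩

/-- The extra hypothesis says that faces run straight through subdivision vertices. Stated on faces,
it covers both genuine vertices of degree 2 and points that are not vertices of `G`. -/
theorem card_face_add_card_le {D : BlockData V} (hD : D.Describes G)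
    (hS' : ∀ v ∉ D.branch,
      R.face (D.fwd v.pred).1 (D.fwd v.pred).2 = R.face (D.fwd v).1 (D.fwd v).2 ∧
      R.face (D.bwd v.succ).1 (D.bwd v.succ).2 = R.face (D.bwd v).1 (D.bwd v).2) :
    Nat.card R.Face + D.chords.card ≤ 11 := by
  have hcover := hD.cover
  obtain ⟨fwd, bwd, t, S, K, x, y⟩ := D
  obtain ⟨hS, hK, hK', -⟩ := hD
  dsimp only at hS hK hK' hcover hS' ⊢
  classical
  choose! s hs using fun v (hv : v ∈ S) => R.exists_face_of_hasNeighbors (hS v hv).2.2.2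
  -- The faces entering and leaving the attachment along the third edge. A subdivision vertex has no
  -- such edge; there both are the forward face, as if a trivial edge pointed to that side.
  let inp : CycleVertex → R.Face := fun v =>
    if v ∈ S then R.face (fwd v).1 (t v) else R.face (fwd v).1 (fwd v).2
  let out : CycleVertex → R.Face := fun v =>
    if v ∈ S then R.face (t v) (fwd v).1 else R.face (fwd v).1 (fwd v).2
  have hblock : ∀ i, ∃ (τ : Perm (Fin 3)) (b : Bool) (e : R.Face),
      (∀ j, inp (i, j) = out (i, τ j)) ∧ (b = true → i ∉ K) ∧ (b = true ∨ i ∈ K → sign τ = -1) ∧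
      (i ∉ K → ∀ j k,
        ((∃ l, R.face (x i j) (y i k) = out l) ∨ (b = true ∧ R.face (x i j) (y i k) = e)) ∧
        ((∃ l, R.face (y i k) (x i j) = out l) ∨ (b = true ∧ R.face (y i k) (x i j) = e))) := by
    intro i
    by_cases hi : i ∈ K
    · obtain ⟨h0, h1, h2, h3, h4⟩ := hK i hi
      -- Tracing along a chord exchanges its ends and fixes the subdivision vertex. There is no
      -- inner face, so the given face is a dummy.
      refine ⟨swap 0 1, false, R.face (fwd (i, 0)).1 (t (i, 0)), ?_, by simp, ?_, fun h => (h hi).elim⟩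
      · intro j
        fin_cases j
        · simp [inp, out, h0, h1, h3, h4]
        · simp [inp, out, h0, h1, h3, h4]
        · have : swap (0 : Fin 3) 1 2 = 2 := by decide
          simp [inp, out, h2, this]
      · intro _; exact sign_swap (by decide)
    · obtain ⟨hx, hy⟩ := hK' i hi
      choose σ hσ using fun j => R.exists_face_of_hasNeighbors (hx j).2.2
      choose σ' hσ' using fun k => R.exists_face_of_hasNeighbors (hy k)
      obtain ⟨τ, b, e, h1, h2, h3⟩ := exists_perm_of_gadget (fun j => inp (i, j))
        (fun j => out (i, j)) (fun j k => R.face (x i j) (y i k))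
        (fun k j => R.face (y i k) (x i j)) σ σ' (by
          intro k j
          have := hσ' k
          cases hk : σ' k <;> rw [hk] at this <;> fin_cases j
          exacts [this.1, this.2.1, this.2.2, this.1, this.2.1, this.2.2]) (by
          intro j
          have h1 := hσ j
          simp only [inp, out, if_pos (hx j).1, (hx j).2.1]
          cases hj : σ j <;> rw [hj] at h1
          · exact ⟨h1.1, h1.2.2, h1.2.1⟩
          · exact h1)
      refine ⟨τ, b, e, h1, fun _ => hi, fun h => h2 (h.resolve_right hi), fun _ j k => ?_⟩
      exact (h3 j k).imp (Or.imp_left fun ⟨l, hl⟩ => ⟨_, hl⟩) (Or.imp_left fun ⟨l, hl⟩ => ⟨_, hl⟩)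
  choose τ b e h1 h2 h3 h4 using hblock
  have hside : ∀ v, if (if v ∈ S then s v else true) then
      R.face (fwd v.pred).1 (fwd v.pred).2 = inp v ∧ out v = R.face (fwd v).1 (fwd v).2 ∧
        R.face (bwd v.succ).1 (bwd v.succ).2 = R.face (bwd v).1 (bwd v).2
      else R.face (fwd v.pred).1 (fwd v.pred).2 = R.face (fwd v).1 (fwd v).2 ∧
        R.face (bwd v.succ).1 (bwd v.succ).2 = inp v ∧ out v = R.face (bwd v).1 (bwd v).2 := by
    intro v
    by_cases hv : v ∈ S
    · have h5 := hs v hv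
      obtain ⟨h6, h7, h8, -⟩ := hS v hv
      simp only [if_pos hv, inp, out, h7, h8, Prod.fst_swap, Prod.snd_swap, h6]
      cases hv' : s v <;> rw [hv'] at h5
      · exact ⟨h5.1, h5.2.2, h5.2.1⟩
      · exact ⟨h5.1, h5.2.1, h5.2.2⟩
    · simp only [if_neg hv, inp, out, if_true]
      exact ⟨(hS' v hv).1, trivial, (hS' v hv).2⟩
  have hout : ∀ v, out v = R.face (fwd v).1 (fwd v).2 ∨ out v = R.face (bwd v).1 (bwd v).2 := by
    intro v
    have := hside v
    split_ifs at this
    exacts [.inl this.2.1, .inr this.2.2, .inl this.2.1, absurd rfl ‹_›]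
  refine CycleVertex.card_add_card_le (fun v => if v ∈ S then s v else true)
    (fun v => R.face (fwd v).1 (fwd v).2) (fun v => R.face (bwd v).1 (bwd v).2) inp out hside τ h1 K
    (Finset.univ.filter fun i => b i = true) ?_ e ?_ ?_
  · rw [Finset.disjoint_left]
    intro i hi hb
    exact h2 i (Finset.mem_filter.mp hb).2 hi
  · intro i hi
    refine h3 i ?_
    simpa [or_comm] using hi
  -- Every face contains a dart; darts of third edges and of copies of `H₃` either lie on a face
  -- that meets the cycle or on the inner face of a block.
  · suffices h : ∀ u w, G.Adj u w →
        (∃ v, R.face u w = R.face (fwd v).1 (fwd v).2 ∨ R.face u w = R.face (bwd v).1 (bwd v).2) ∨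
          ∃ i ∈ Finset.univ.filter (fun i => b i = true), R.face u w = e i by
      rintro ⟨⟨⟨u, w⟩, huw⟩⟩
      have hface : R.face u w = ⟦⟨(u, w), huw⟩⟧ := by rw [face, dif_pos huw]
      have h5 := h u w huw
      rw [hface] at h5
      exact h5
    intro u w huw
    have hof : ∀ v, R.face u w = out v →
        ∃ v, R.face u w = R.face (fwd v).1 (fwd v).2 ∨ R.face u w = R.face (bwd v).1 (bwd v).2 :=
      fun v hv => ⟨v, (hout v).imp hv.trans hv.trans⟩
    rcases hcover u w huw with ⟨v, hv⟩ | ⟨v, hvS, hv⟩ | ⟨i, hi, j, k, hv⟩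
    · refine .inl ⟨v, hv.imp (fun h => ?_) fun h => ?_⟩ <;> rw [← h]
    · left
      rcases hv with hv | hv
      · refine hof (v.1, τ v.1 v.2) ?_
        rw [← h1]
        simp only [Prod.mk.injEq] at hv
        simp only [inp, if_pos hvS, hv.1, hv.2]
      · refine hof v ?_
        simp only [Prod.mk.injEq] at hv
        simp only [out, if_pos hvS, hv.1, hv.2]
    · have h5 := h4 i hi j k
      rcases hv with hv | hv <;> simp only [Prod.mk.injEq] at hv <;> obtain ⟨rfl, rfl⟩ := hv
      · rcases h5.1 with ⟨l, hl⟩ | ⟨hb, he⟩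
        · exact .inl (hof l hl)
        · exact .inr ⟨i, by simpa using hb, he⟩
      · rcases h5.2 with ⟨l, hl⟩ | ⟨hb, he⟩
        · exact .inl (hof l hl)
        · exact .inr ⟨i, by simpa using hb, he⟩

end RotationSystem

end SimpleGraph

/-! ### Checkable certificates for the number of faces -/

/-- The invariant label keeps cycles apart, and the decreasing rank leads each element to the
representative of its label. All conditions are local, so they can be decided without computing
orbits. -/
theorem Equiv.Perm.numCycles_eq_card {α β : Type*} (f : Perm α) (lab : α → β) (rep : β → α)
    (rank : α → ℕ) (hlab : ∀ a, lab (f a) = lab a) (hrep : ∀ b, lab (rep b) = b)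
    (hrank : ∀ a, rank (f a) < rank a ∨ a = rep (lab a)) : f.numCycles = Nat.card β := by
  have key : ∀ n a, rank a ≤ n → SameCycle f a (rep (lab a)) := by
    intro n
    induction n with
    | zero =>
      intro a ha
      have := (hrank a).resolve_left (by omega)
      rw [← this]
    | succ n ih =>
      intro a ha
      rcases hrank a with h | h
      · have := ih (f a) (by omega)
        rw [hlab] at this
        exact sameCycle_apply_left.mp this
      · rw [← h]
  refine Nat.card_congr ⟨Quotient.lift lab fun a b h => SameCycle.apply_eq h lab hlab,
    fun b => ⟦rep b⟧, ?_, hrep⟩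
  rintro ⟨a⟩
  exact Quotient.sound (key _ a le_rfl).symm

namespace SimpleGraph

section ofCyclicOrders

variable {V : Type*} [DecidableEq V] {G : SimpleGraph V}

/-- The permutation of the darts given by a cyclic ordering of the neighbours of each vertex. -/
def dartPerm (rot : V → List V) (hadj : ∀ u v, G.Adj u v ↔ v ∈ rot u) : Perm G.Dart where
  toFun d := ⟨(d.fst, (rot d.fst).formPerm d.snd),
    (hadj _ _).mpr (List.formPerm_apply_mem_of_mem ((hadj _ _).mp d.adj))⟩
  invFun d := ⟨(d.fst, (rot d.fst).formPerm⁻¹ d.snd),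
    (hadj _ _).mpr (List.mem_of_formPerm_apply_mem (by
      rw [← mul_apply, mul_inv_cancel]; exact (hadj _ _).mp d.adj))⟩
  left_inv d := SimpleGraph.Dart.ext _ _ (Prod.ext rfl (by simp))
  right_inv d := SimpleGraph.Dart.ext _ _ (Prod.ext rfl (by simp))

theorem dartPerm_zpow_apply (rot : V → List V) (hadj : ∀ u v, G.Adj u v ↔ v ∈ rot u) (n : ℤ) :
    ∀ d, ((dartPerm rot hadj ^ n) d).toProd = (d.fst, ((rot d.fst).formPerm ^ n) d.snd) := by
  induction n with
  | zero => simp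
  | succ n ih => intro d; rw [zpow_add_one, mul_apply, ih, zpow_add_one, mul_apply]; rfl
  | pred n ih => intro d; rw [zpow_sub_one, mul_apply, ih, zpow_sub_one, mul_apply]; rfl

/-- The rotation system given by a cyclic ordering of the neighbours of each vertex. -/
def RotationSystem.ofCyclicOrders (rot : V → List V) (hnd : ∀ v, (rot v).Nodup)
    (hadj : ∀ u v, G.Adj u v ↔ v ∈ rot u) : G.RotationSystem where
  next := dartPerm rot hadj
  fst_next _ := rfl
  sameCycle_of_fst_eq := by
    rintro ⟨⟨v, u⟩, hu⟩ ⟨⟨v', w⟩, hw⟩ rfl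
    obtain ⟨n, hn⟩ := (hnd v).isCycleOn_formPerm.2 ((hadj _ _).mp hu) ((hadj _ _).mp hw)
    exact ⟨n, SimpleGraph.Dart.ext _ _ ((dartPerm_zpow_apply rot hadj n _).trans
      (Prod.ext rfl hn))⟩

theorem RotationSystem.numFaces_ofCyclicOrders (rot : V → List V) (hnd : ∀ v, (rot v).Nodup)
    (hadj : ∀ u v, G.Adj u v ↔ v ∈ rot u) {F : ℕ} (hF : 1 ≤ F) (lab rank : V → V → ℕ)
    (rep : ℕ → V × V)
    (hlab : ∀ u, ∀ v ∈ rot u, lab u v < F ∧ lab v ((rot v).formPerm u) = lab u v ∧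
      (rank v ((rot v).formPerm u) < rank u v ∨ (u, v) = rep (lab u v)))
    (hrep : ∀ i < F, (rep i).2 ∈ rot (rep i).1 ∧ lab (rep i).1 (rep i).2 = i) :
    (ofCyclicOrders rot hnd hadj).numFaces = F := by
  have h := Equiv.Perm.numCycles_eq_card (ofCyclicOrders rot hnd hadj).facePerm
    (β := Fin F) (fun d => ⟨lab d.fst d.snd, (hlab _ _ ((hadj _ _).mp d.adj)).1⟩)
    (fun i => ⟨rep i, (hadj _ _).mpr (hrep i i.2).1⟩) (fun d => rank d.fst d.snd)
    (fun d => Fin.ext (hlab _ _ ((hadj _ _).mp d.adj)).2.1) (fun i => Fin.ext (hrep i i.2).2)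
    (fun d => (hlab _ _ ((hadj _ _).mp d.adj)).2.2.imp id fun h => SimpleGraph.Dart.ext _ _ h)
  rw [Nat.card_fin] at h
  rw [numFaces, show Nat.card _ = F from h]
  exact max_eq_right hF

end ofCyclicOrders

section scaffold

variable {V ι : Type*} [DecidableEq V] [DecidableEq ι] {G : SimpleGraph V} [DecidableRel G.Adj]

instance : DecidableRel (completeBipartiteGraph V ι).Adj := fun _ _ =>
  inferInstanceAs (Decidable (_ ∨ _))

instance (T : ι → Fin 3 → V) : DecidableRel (G.scaffold T).Adj
  | .inl u, .inl v => inferInstanceAs (Decidable (G.Adj u v))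
  | .inl u, .inr (i, .inl j) => inferInstanceAs (Decidable (u = T i j))
  | .inr (i, .inl j), .inl u => inferInstanceAs (Decidable (u = T i j))
  | .inl _, .inr (_, .inr _) => inferInstanceAs (Decidable False)
  | .inr (_, .inr _), .inl _ => inferInstanceAs (Decidable False)
  | .inr (i, .inl x), .inr (i', .inl y) =>
    inferInstanceAs (Decidable (i = i' ∧ (completeBipartiteGraph (Fin 3) (Fin 2)).Adj (.inl x) (.inl y)))
  | .inr (i, .inl x), .inr (i', .inr y) =>
    inferInstanceAs (Decidable (i = i' ∧ (completeBipartiteGraph (Fin 3) (Fin 2)).Adj (.inl x) (.inr y)))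
  | .inr (i, .inr x), .inr (i', .inl y) =>
    inferInstanceAs (Decidable (i = i' ∧ (completeBipartiteGraph (Fin 3) (Fin 2)).Adj (.inr x) (.inl y)))
  | .inr (i, .inr x), .inr (i', .inr y) =>
    inferInstanceAs (Decidable (i = i' ∧ (completeBipartiteGraph (Fin 3) (Fin 2)).Adj (.inr x) (.inr y)))

end scaffold

/-- The vertices of a scaffolded graph. -/
abbrev ScaffoldVertex (n m : ℕ) := Fin n ⊕ (Fin m × (Fin 3 ⊕ Fin 2))

namespace ScaffoldVertex

variable {n m : ℕ}

/-- The vertices of a scaffolded graph, numbered consecutively. -/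
def index : ScaffoldVertex n m → ℕ
  | .inl v => v
  | .inr (i, .inl j) => n + 5 * i + j
  | .inr (i, .inr k) => n + 5 * i + 3 + k

/-- The vertex of a scaffolded graph with a given number. -/
def ofIndex [NeZero n] [NeZero m] (a : ℕ) : ScaffoldVertex n m :=
  if a < n then .inl (Fin.ofNat n a)
  else .inr (Fin.ofNat m ((a - n) / 5),
    if (a - n) % 5 < 3 then .inl (Fin.ofNat 3 ((a - n) % 5)) else .inr (Fin.ofNat 2 ((a - n) % 5 - 3)))

end ScaffoldVertex

/-- A table of a rotation system and its faces: its `v`-th row lists the neighbours `w` of the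
vertex number `v` in cyclic order, each with the number of the face to which the dart from `v` to
`w` belongs and the number of steps from this dart to the representative of that face. -/
abbrev FaceTable := List (List (ℕ × ℕ × ℕ))

namespace FaceTable

open ScaffoldVertex

variable {n m : ℕ} [NeZero n] [NeZero m] (t : FaceTable)

/-- The neighbours of a vertex in cyclic order. -/
def rot (v : ScaffoldVertex n m) : List (ScaffoldVertex n m) :=
  (t.getD v.index []).map fun e => ofIndex e.1

/-- The number of a face and the number of steps to its representative. -/
def entry (u v : ScaffoldVertex n m) : ℕ × ℕ :=
  (((t.getD u.index []).find? fun e => e.1 == v.index).getD (0, 0, 0)).2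

/-- The representative of the face number `i`. -/
def rep (i : ℕ) : ScaffoldVertex n m × ScaffoldVertex n m :=
  (((t.zipIdx.flatMap fun r => r.1.filterMap fun e =>
    if e.2 = (i, 0) then some (ofIndex r.2, ofIndex e.1) else none)).head?).getD
      (ofIndex 0, ofIndex 0)

/-- The table describes a rotation system of `G` with `F` faces. -/
def IsValid (G : SimpleGraph (ScaffoldVertex n m)) (F : ℕ) : Prop :=
  1 ≤ F ∧ (∀ v : ScaffoldVertex n m, (t.rot v).Nodup) ∧ (∀ u v, G.Adj u v ↔ v ∈ t.rot u) ∧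
    (∀ u : ScaffoldVertex n m, ∀ v ∈ t.rot u, (t.entry u v).1 < F ∧
      (t.entry v ((t.rot v).formPerm u)).1 = (t.entry u v).1 ∧
      ((t.entry v ((t.rot v).formPerm u)).2 < (t.entry u v).2 ∨ (u, v) = t.rep (t.entry u v).1)) ∧
    ∀ i < F, (t.rep i : ScaffoldVertex n m × ScaffoldVertex n m).2 ∈ t.rot (t.rep i).1 ∧
      (t.entry (t.rep i : ScaffoldVertex n m × ScaffoldVertex n m).1 (t.rep i).2).1 = i

instance (v : ScaffoldVertex n m) (l : List (ScaffoldVertex n m)) : Decidable (v ∈ l) :=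
  @List.instDecidableMemOfLawfulBEq _ instBEqOfDecidableEq _ v l

set_option synthInstance.maxSize 2000 in
instance (G : SimpleGraph (ScaffoldVertex n m)) [DecidableRel G.Adj] (F : ℕ) :
    Decidable (t.IsValid G F) :=
  inferInstanceAs (Decidable (_ ∧ _))

variable {t} in
theorem IsValid.exists_numFaces_eq {G : SimpleGraph (ScaffoldVertex n m)} {F : ℕ}
    (h : t.IsValid G F) : ∃ R : G.RotationSystem, R.numFaces = F :=
  ⟨.ofCyclicOrders t.rot h.2.1 h.2.2.1, RotationSystem.numFaces_ofCyclicOrders t.rot h.2.1 h.2.2.1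
    h.1 (fun u v => (t.entry u v).1) (fun u v => (t.entry u v).2) t.rep h.2.2.2.1 h.2.2.2.2⟩

end FaceTable

theorem Connected.of_rank {V : Type*} {G : SimpleGraph V} (r : V) (rank : V → ℕ)
    (h : ∀ v, v = r ∨ ∃ w, G.Adj v w ∧ rank w < rank v) : G.Connected := by
  have key : ∀ n v, rank v ≤ n → G.Reachable v r := by
    intro n
    induction n with
    | zero =>
      intro v hv
      rcases h v with rfl | ⟨w, -, hw⟩
      · rfl
      · omega
    | succ n ih =>
      intro v hv
      rcases h v with rfl | ⟨w, hvw, hw⟩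
      · rfl
      · exact hvw.reachable.trans (ih w (by omega))
  have : Nonempty V := ⟨r⟩
  exact ⟨fun u v => (key _ u le_rfl).trans (key _ v le_rfl).symm⟩

theorem minGenus_eq {V : Type*} {G : SimpleGraph V} {k : ℕ} (hk : G.CellularEmbedsIn k)
    (h : ∀ l, G.CellularEmbedsIn l → k ≤ l) : G.minGenus = k :=
  IsLeast.csInf_eq ⟨hk, h⟩

theorem maxGenus_eq {V : Type*} {G : SimpleGraph V} {k : ℕ} (hk : G.CellularEmbedsIn k)
    (h : ∀ l, G.CellularEmbedsIn l → l ≤ k) : G.maxGenus = k :=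
  IsGreatest.csSup_eq ⟨hk, h⟩

theorem card_edgeSet_eq {V : Type*} [Fintype V] (G : SimpleGraph V) [DecidableRel G.Adj] {e : ℕ}
    (h : ∑ v, G.degree v = 2 * e) : Nat.card G.edgeSet = e := by
  classical
  rw [Nat.card_eq_fintype_card, ← edgeFinset_card]
  have := G.sum_degrees_eq_twice_card_edges
  omega

end SimpleGraph

/-! ### The three graphs and explicit rotation systems -/

open SimpleGraph

instance : DecidableRel graphG4.Adj :=
  inferInstanceAs (DecidableRel (_ ⊔ fromEdgeSet ({s(0, 5), s(4, 9)} : Set _)).Adj)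

instance : DecidableRel graphG5.Adj :=
  inferInstanceAs (DecidableRel (_ ⊔ fromEdgeSet ({s(0, 5)} : Set _)).Adj)

instance : DecidableRel graphG6.Adj := inferInstanceAs (DecidableRel (cycleGraph 15).Adj)

instance : DecidableRel graphM4.Adj :=
  inferInstanceAs (DecidableRel (graphG4.scaffold triplesG4).Adj)

instance : DecidableRel graphM5.Adj :=
  inferInstanceAs (DecidableRel (graphG5.scaffold triplesG5).Adj)

instance : DecidableRel graphM6.Adj :=
  inferInstanceAs (DecidableRel (graphG6.scaffold triplesG6).Adj)

theorem graphM4_connected : graphM4.Connected :=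
  .of_rank (.inl 0) ScaffoldVertex.index (by decide +kernel)

theorem graphM5_connected : graphM5.Connected :=
  .of_rank (.inl 0) ScaffoldVertex.index (by decide +kernel)

theorem graphM6_connected : graphM6.Connected :=
  .of_rank (.inl 0) ScaffoldVertex.index (by decide +kernel)

theorem card_edgeSet_graphM4 : Nat.card graphM4.edgeSet = 42 := card_edgeSet_eq _ (by decide +kernel)

theorem card_edgeSet_graphM5 : Nat.card graphM5.edgeSet = 52 := card_edgeSet_eq _ (by decide +kernel)

theorem card_edgeSet_graphM6 : Nat.card graphM6.edgeSet = 60 := card_edgeSet_eq _ (by decide +kernel)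

/-- A rotation system of `M₄` with two faces. -/
def rotationM4Two : FaceTable :=
  [[(1, 0, 0), (5, 1, 0), (12, 1, 16)], [(0, 1, 1), (2, 0, 41), (13, 0, 16)],
   [(1, 0, 17), (3, 0, 40), (18, 1, 31)], [(2, 1, 32), (4, 0, 39), (23, 0, 7)],
   [(3, 0, 8), (5, 0, 38), (9, 1, 40)], [(0, 1, 17), (4, 1, 41), (6, 0, 37)],
   [(5, 1, 18), (7, 0, 36), (14, 1, 7)], [(6, 1, 8), (8, 0, 35), (19, 0, 23)],
   [(7, 0, 24), (9, 0, 34), (24, 1, 38)], [(4, 0, 9), (8, 1, 39), (10, 0, 33)],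
   [(9, 0, 10), (11, 0, 32), (15, 1, 24)], [(10, 1, 25), (12, 0, 31), (20, 1, 14)],
   [(0, 0, 1), (11, 1, 15), (25, 0, 30)], [(1, 1, 2), (16, 0, 15), (17, 1, 21)],
   [(6, 1, 19), (16, 1, 6), (17, 0, 13)], [(10, 0, 11), (16, 1, 23), (17, 1, 4)],
   [(13, 1, 22), (14, 0, 14), (15, 1, 5)], [(13, 1, 3), (14, 1, 20), (15, 0, 12)],
   [(2, 0, 18), (21, 1, 30), (22, 1, 11)], [(7, 1, 9), (21, 0, 22), (22, 1, 28)],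
   [(11, 1, 26), (21, 1, 13), (22, 0, 20)], [(18, 1, 12), (19, 1, 29), (20, 0, 21)],
   [(18, 0, 19), (19, 1, 10), (20, 1, 27)], [(3, 1, 33), (26, 0, 6), (27, 0, 27)],
   [(8, 0, 25), (26, 1, 37), (27, 0, 4)], [(12, 0, 2), (26, 0, 29), (27, 1, 35)],
   [(23, 0, 28), (24, 0, 5), (25, 1, 36)], [(23, 1, 34), (24, 0, 26), (25, 0, 3)]]

theorem isValid_rotationM4Two : rotationM4Two.IsValid graphM4 2 := by
  decide +kernel

/-- A rotation system of `M₄` with eight faces. -/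
def rotationM4Eight : FaceTable :=
  [[(1, 0, 0), (12, 2, 0), (5, 1, 0)], [(0, 2, 1), (13, 0, 6), (2, 3, 0)],
   [(1, 2, 2), (3, 3, 25), (18, 4, 0)], [(2, 4, 1), (4, 3, 24), (23, 3, 10)],
   [(3, 3, 11), (5, 3, 23), (9, 1, 11)], [(0, 0, 1), (4, 1, 12), (6, 3, 22)],
   [(5, 0, 2), (7, 3, 21), (14, 3, 4)], [(6, 3, 5), (19, 3, 20), (8, 3, 14)],
   [(7, 3, 6), (9, 3, 13), (24, 4, 5)], [(4, 3, 12), (10, 1, 10), (8, 4, 6)],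
   [(9, 4, 7), (15, 1, 9), (11, 1, 3)], [(10, 4, 8), (12, 1, 2), (20, 2, 6)],
   [(0, 1, 1), (25, 2, 13), (11, 2, 7)], [(1, 3, 1), (17, 0, 5), (16, 5, 0)],
   [(6, 0, 3), (16, 3, 3), (17, 1, 6)], [(10, 1, 4), (16, 1, 8), (17, 5, 2)],
   [(13, 3, 2), (15, 5, 3), (14, 1, 7)], [(13, 5, 1), (14, 0, 4), (15, 1, 5)],
   [(2, 2, 3), (22, 4, 11), (21, 6, 0)], [(7, 3, 15), (21, 3, 19), (22, 6, 2)],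
   [(11, 4, 9), (21, 2, 5), (22, 3, 17)], [(18, 2, 4), (19, 6, 3), (20, 3, 18)],
   [(18, 6, 1), (20, 4, 10), (19, 3, 16)], [(3, 4, 2), (27, 3, 9), (26, 7, 0)],
   [(8, 3, 7), (26, 4, 4), (27, 2, 10)], [(12, 2, 8), (26, 2, 12), (27, 7, 2)],
   [(23, 4, 3), (25, 7, 3), (24, 2, 11)], [(23, 7, 1), (24, 3, 8), (25, 2, 9)]]

theorem isValid_rotationM4Eight : rotationM4Eight.IsValid graphM4 8 := by
  decide +kernel

/-- A rotation system of `M₅` with one face. -/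
def rotationM5One : FaceTable :=
  [[(1, 0, 0), (5, 0, 9), (14, 0, 61)], [(0, 0, 10), (2, 0, 103), (15, 0, 45)],
   [(1, 0, 46), (3, 0, 102), (20, 0, 76)], [(2, 0, 77), (4, 0, 101), (25, 0, 30)],
   [(3, 0, 31), (5, 0, 100), (30, 0, 7)], [(0, 0, 62), (4, 0, 8), (6, 0, 99)],
   [(5, 0, 63), (7, 0, 98), (16, 0, 16)], [(6, 0, 17), (8, 0, 97), (21, 0, 52)],
   [(7, 0, 53), (9, 0, 96), (26, 0, 83)], [(8, 0, 84), (10, 0, 95), (31, 0, 37)],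
   [(9, 0, 38), (11, 0, 94)], [(10, 0, 39), (12, 0, 93), (17, 0, 69)],
   [(11, 0, 70), (13, 0, 92), (22, 0, 23)], [(12, 0, 24), (14, 0, 91), (27, 0, 59)],
   [(0, 0, 1), (13, 0, 60), (32, 0, 90)], [(1, 0, 11), (18, 0, 44), (19, 0, 66)],
   [(6, 0, 64), (18, 0, 15), (19, 0, 42)], [(11, 0, 40), (18, 0, 68), (19, 0, 13)],
   [(15, 0, 67), (16, 0, 43), (17, 0, 14)], [(15, 0, 12), (16, 0, 65), (17, 0, 41)],
   [(2, 0, 47), (23, 0, 75), (24, 0, 20)], [(7, 0, 18), (23, 0, 51), (24, 0, 73)],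
   [(12, 0, 71), (23, 0, 22), (24, 0, 49)], [(20, 0, 21), (21, 0, 74), (22, 0, 50)],
   [(20, 0, 48), (21, 0, 19), (22, 0, 72)], [(3, 0, 78), (28, 0, 29), (29, 0, 56)],
   [(8, 0, 54), (28, 0, 82), (29, 0, 27)], [(13, 0, 25), (28, 0, 58), (29, 0, 80)],
   [(25, 0, 57), (26, 0, 28), (27, 0, 81)], [(25, 0, 79), (26, 0, 55), (27, 0, 26)],
   [(4, 0, 32), (33, 0, 6), (34, 0, 87)], [(9, 0, 85), (33, 0, 36), (34, 0, 4)],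
   [(14, 0, 2), (33, 0, 89), (34, 0, 34)], [(30, 0, 88), (31, 0, 5), (32, 0, 35)],
   [(30, 0, 33), (31, 0, 86), (32, 0, 3)]]

theorem isValid_rotationM5One : rotationM5One.IsValid graphM5 1 := by
  decide +kernel

/-- A rotation system of `M₅` with nine faces. -/
def rotationM5Nine : FaceTable :=
  [[(1, 0, 0), (5, 1, 0), (14, 2, 0)], [(0, 1, 1), (2, 0, 14), (15, 1, 7)],
   [(1, 1, 8), (20, 0, 13), (3, 3, 0)], [(2, 1, 9), (25, 3, 15), (4, 2, 13)],
   [(3, 1, 10), (30, 2, 12), (5, 4, 0)], [(0, 2, 1), (4, 1, 11), (6, 4, 8)],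
   [(5, 2, 2), (7, 4, 7), (16, 0, 8)], [(6, 0, 9), (8, 4, 6), (21, 5, 0)],
   [(7, 5, 1), (9, 4, 5), (26, 5, 7)], [(8, 5, 8), (31, 4, 4), (10, 2, 8)],
   [(9, 5, 9), (11, 2, 7)], [(10, 5, 10), (17, 2, 6), (12, 0, 4)],
   [(11, 5, 11), (13, 0, 3), (22, 3, 10)], [(12, 3, 11), (14, 0, 2), (27, 2, 17)],
   [(0, 0, 1), (32, 2, 24), (13, 2, 18)], [(1, 1, 2), (19, 1, 6), (18, 6, 0)],
   [(6, 2, 3), (19, 0, 7), (18, 1, 4)], [(11, 0, 5), (18, 2, 5), (19, 6, 2)],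
   [(15, 1, 3), (17, 6, 3), (16, 2, 4)], [(15, 6, 1), (16, 1, 5), (17, 0, 6)],
   [(2, 3, 1), (24, 0, 12), (23, 3, 7)], [(7, 0, 10), (23, 5, 14), (24, 3, 5)],
   [(12, 5, 12), (24, 3, 9), (23, 3, 3)], [(20, 3, 2), (21, 3, 6), (22, 5, 13)],
   [(20, 3, 8), (21, 0, 11), (22, 3, 4)], [(3, 2, 14), (28, 3, 14), (29, 5, 4)],
   [(8, 5, 2), (28, 5, 6), (29, 7, 0)], [(13, 3, 12), (29, 2, 16), (28, 7, 2)],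
   [(25, 5, 5), (27, 3, 13), (26, 7, 1)], [(25, 2, 15), (26, 5, 3), (27, 7, 3)],
   [(4, 4, 1), (34, 2, 11), (33, 2, 21)], [(9, 2, 9), (33, 4, 3), (34, 8, 0)],
   [(14, 2, 19), (34, 2, 23), (33, 8, 2)], [(30, 4, 2), (32, 2, 20), (31, 8, 1)],
   [(30, 2, 22), (31, 2, 10), (32, 8, 3)]]

theorem isValid_rotationM5Nine : rotationM5Nine.IsValid graphM5 9 := by
  decide +kernel

/-- A rotation system of `M₆` with two faces. -/
def rotationM6Two : FaceTable :=
  [[(1, 0, 0), (14, 1, 0), (15, 1, 35)], [(0, 1, 1), (2, 0, 47), (20, 1, 56)],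
   [(1, 1, 57), (3, 0, 46), (25, 0, 20)], [(2, 0, 21), (4, 0, 45), (30, 1, 21)],
   [(3, 1, 22), (5, 0, 44), (35, 1, 42)], [(4, 1, 43), (6, 0, 43), (16, 0, 6)],
   [(5, 0, 7), (7, 0, 42), (21, 1, 7)], [(6, 1, 8), (8, 0, 41), (26, 1, 63)],
   [(7, 1, 64), (9, 0, 40), (31, 0, 27)], [(8, 0, 28), (10, 0, 39), (36, 1, 28)],
   [(9, 1, 29), (11, 0, 38), (17, 1, 49)], [(10, 1, 50), (12, 0, 37), (22, 0, 13)],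
   [(11, 0, 14), (13, 0, 36), (27, 1, 14)], [(12, 1, 15), (14, 0, 35), (32, 1, 70)],
   [(0, 1, 36), (13, 1, 71), (37, 0, 34)], [(0, 0, 1), (18, 1, 34), (19, 1, 46)],
   [(5, 1, 44), (18, 0, 5), (19, 1, 32)], [(10, 1, 30), (18, 1, 48), (19, 0, 3)],
   [(15, 1, 47), (16, 1, 33), (17, 0, 4)], [(15, 0, 2), (16, 1, 45), (17, 1, 31)],
   [(1, 1, 2), (23, 1, 55), (24, 0, 10)], [(6, 0, 8), (23, 1, 6), (24, 1, 53)],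
   [(11, 1, 51), (23, 0, 12), (24, 1, 4)], [(20, 0, 11), (21, 1, 54), (22, 1, 5)],
   [(20, 1, 3), (21, 0, 9), (22, 1, 52)], [(2, 1, 58), (28, 0, 19), (29, 1, 11)],
   [(7, 1, 9), (28, 1, 62), (29, 0, 17)], [(12, 0, 15), (28, 1, 13), (29, 1, 60)],
   [(25, 1, 12), (26, 0, 18), (27, 1, 61)], [(25, 1, 59), (26, 1, 10), (27, 0, 16)],
   [(3, 0, 22), (33, 1, 20), (34, 1, 67)], [(8, 1, 65), (33, 0, 26), (34, 1, 18)],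
   [(13, 1, 16), (33, 1, 69), (34, 0, 24)], [(30, 1, 68), (31, 1, 19), (32, 0, 25)],
   [(30, 0, 23), (31, 1, 66), (32, 1, 17)], [(4, 1, 23), (38, 1, 41), (39, 0, 31)],
   [(9, 0, 29), (38, 1, 27), (39, 1, 39)], [(14, 1, 37), (38, 0, 33), (39, 1, 25)],
   [(35, 0, 32), (36, 1, 40), (37, 1, 26)], [(35, 1, 24), (36, 0, 30), (37, 1, 38)]]

theorem isValid_rotationM6Two : rotationM6Two.IsValid graphM6 2 := by
  decide +kernel

/-- A rotation system of `M₆` with ten faces. -/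
def rotationM6Ten : FaceTable :=
  [[(1, 0, 0), (14, 1, 0), (15, 2, 0)], [(0, 1, 1), (2, 0, 47), (20, 0, 9)],
   [(1, 0, 10), (25, 0, 46), (3, 0, 40)], [(2, 0, 11), (4, 0, 39), (30, 0, 17)],
   [(3, 0, 18), (35, 0, 38), (5, 3, 0)], [(4, 0, 19), (16, 3, 14), (6, 3, 8)],
   [(5, 0, 20), (7, 3, 7), (21, 0, 26)], [(6, 0, 27), (8, 3, 6), (26, 4, 0)],
   [(7, 4, 1), (9, 3, 5), (31, 2, 6)], [(8, 2, 7), (36, 3, 4), (10, 0, 34)],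
   [(9, 2, 8), (11, 0, 33), (17, 0, 4)], [(10, 0, 5), (12, 0, 32), (22, 1, 5)],
   [(11, 1, 6), (27, 0, 31), (13, 4, 6)], [(12, 1, 7), (32, 4, 5), (14, 2, 2)],
   [(0, 2, 1), (37, 1, 14), (13, 1, 8)], [(0, 0, 1), (19, 2, 11), (18, 3, 11)],
   [(5, 3, 9), (19, 3, 13), (18, 5, 0)], [(10, 2, 9), (18, 0, 3), (19, 5, 2)],
   [(15, 0, 2), (16, 3, 10), (17, 5, 3)], [(15, 3, 12), (17, 2, 10), (16, 5, 1)],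
   [(1, 1, 2), (24, 0, 8), (23, 6, 0)], [(6, 0, 21), (23, 0, 25), (24, 6, 2)],
   [(11, 0, 6), (23, 1, 4), (24, 0, 23)], [(20, 1, 3), (21, 6, 3), (22, 0, 24)],
   [(20, 6, 1), (22, 0, 7), (21, 0, 22)], [(2, 0, 41), (28, 0, 45), (29, 7, 0)],
   [(7, 0, 28), (29, 4, 9), (28, 7, 2)], [(12, 4, 7), (28, 0, 30), (29, 0, 43)],
   [(25, 7, 1), (27, 0, 44), (26, 0, 29)], [(25, 0, 42), (26, 7, 3), (27, 4, 8)],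
   [(3, 0, 12), (34, 0, 16), (33, 8, 0)], [(8, 4, 2), (34, 2, 5), (33, 0, 14)],
   [(13, 2, 3), (33, 4, 4), (34, 8, 2)], [(30, 0, 13), (32, 8, 3), (31, 4, 3)],
   [(30, 8, 1), (31, 0, 15), (32, 2, 4)], [(4, 3, 1), (38, 0, 37), (39, 1, 11)],
   [(9, 0, 35), (39, 3, 3), (38, 9, 0)], [(14, 1, 9), (38, 1, 13), (39, 9, 2)],
   [(35, 1, 12), (36, 0, 36), (37, 9, 3)], [(35, 3, 2), (37, 1, 10), (36, 9, 1)]]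

theorem isValid_rotationM6Ten : rotationM6Ten.IsValid graphM6 10 := by
  decide +kernel

/-! ### Block decompositions and upper bounds on faces -/

/-- The decomposition of `M₄`; `c₀` and `c₄` stand for subdivision vertices of the edges `d₃c₀`
and `c₂d₀`, the blocks `0` and `4` for the chords. -/
def blockDataM4 : BlockData (Fin 13 ⊕ (Fin 3 × (Fin 3 ⊕ Fin 2))) :=
  let p : CycleVertex → Fin 13 := fun v =>
    (![![0, 5, 9], ![1, 6, 10], ![2, 7, 11], ![3, 8, 12], ![4, 9, 12]] v.1) v.2
  let copy : Fin 5 → Fin 3 := ![0, 0, 1, 2, 0]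
  { fwd := fun v => (.inl (p v), .inl (p v + 1))
    bwd := fun v => if v = (0, 2) then (.inl 10, .inl 9) else if v = (4, 2) then (.inl 0, .inl 12)
      else (.inl (p v), .inl (p v - 1))
    third := fun v => if v.1 = 0 then .inl (![5, 0, 0] v.2) else
      if v.1 = 4 then .inl (![9, 4, 0] v.2) else .inr (copy v.1, .inl v.2)
    branch := Finset.univ \ {(0, 2), (4, 2)}
    chords := {0, 4}
    x := fun i j => .inr (copy i, .inl j)
    y := fun i k => .inr (copy i, .inr k) }

/-- The decomposition of `M₅`. -/
def blockDataM5 : BlockData (Fin 15 ⊕ (Fin 4 × (Fin 3 ⊕ Fin 2))) :=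
  let p : CycleVertex → Fin 15 := fun v =>
    (![![0, 5, 10], ![1, 6, 11], ![2, 7, 12], ![3, 8, 13], ![4, 9, 14]] v.1) v.2
  let copy : Fin 5 → Fin 4 := ![0, 0, 1, 2, 3]
  { fwd := fun v => (.inl (p v), .inl (p v + 1))
    bwd := fun v => (.inl (p v), .inl (p v - 1))
    third := fun v => if v.1 = 0 then .inl (![5, 0, 0] v.2) else .inr (copy v.1, .inl v.2)
    branch := Finset.univ \ {(0, 2)}
    chords := {0}
    x := fun i j => .inr (copy i, .inl j)
    y := fun i k => .inr (copy i, .inr k) }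

/-- The decomposition of `M₆`. -/
def blockDataM6 : BlockData (Fin 15 ⊕ (Fin 5 × (Fin 3 ⊕ Fin 2))) :=
  let p : CycleVertex → Fin 15 := fun v =>
    (![![0, 5, 10], ![1, 6, 11], ![2, 7, 12], ![3, 8, 13], ![4, 9, 14]] v.1) v.2
  { fwd := fun v => (.inl (p v), .inl (p v + 1))
    bwd := fun v => (.inl (p v), .inl (p v - 1))
    third := fun v => .inr (v.1, .inl v.2)
    branch := Finset.univ
    chords := ∅
    x := fun i j => .inr (i, .inl j)
    y := fun i k => .inr (i, .inr k) }

theorem blockDataM4_describes : blockDataM4.Describes graphM4 := by decide +kernel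

theorem blockDataM5_describes : blockDataM5.Describes graphM5 := by decide +kernel

theorem blockDataM6_describes : blockDataM6.Describes graphM6 := by decide +kernel

theorem graphM4_numFaces_le (R : graphM4.RotationSystem) : R.numFaces ≤ 9 := by
  have : Nonempty graphM4.Dart := ⟨⟨(.inl 0, .inl 1), by decide +kernel⟩⟩
  have h := R.card_face_add_card_le blockDataM4_describes (by
    intro v hv
    obtain rfl | rfl : v = (0, 2) ∨ v = (4, 2) := by
      revert v; decide +kernel
    -- The two added points subdivide edges only formally: the darts before and after them are the
    -- same dart of the graph.
    · exact ⟨rfl, rfl⟩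
    · exact ⟨rfl, rfl⟩)
  -- The two chords turn the bound 11 into 9.
  exact max_le (by norm_num) (Nat.le_of_add_le_add_right h)

theorem graphM5_numFaces_le (R : graphM5.RotationSystem) : R.numFaces ≤ 10 := by
  have : Nonempty graphM5.Dart := ⟨⟨(.inl 0, .inl 1), by decide +kernel⟩⟩
  have h := R.card_face_add_card_le blockDataM5_describes (by
    intro v hv
    obtain rfl : v = (0, 2) := by revert v; decide +kernel
    -- Here the subdivision point is a genuine vertex, `c₀`, of degree 2.
    exact R.face_of_two_neighbors (v := .inl 10) (a := .inl 9) (b := .inl 11) (by decide)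
      (by decide +kernel))
  exact max_le (by norm_num) (Nat.le_of_add_le_add_right h)

theorem graphM6_numFaces_le (R : graphM6.RotationSystem) : R.numFaces ≤ 11 := by
  have : Nonempty graphM6.Dart := ⟨⟨(.inl 0, .inl 1), by decide +kernel⟩⟩
  have h := R.card_face_add_card_le blockDataM6_describes
    fun v hv => (hv (Finset.mem_univ v)).elim
  exact max_le (by norm_num) h

theorem SimpleGraph.RotationSystem.one_le_numFaces {V : Type*} {G : SimpleGraph V}
    (R : G.RotationSystem) : 1 ≤ R.numFaces := le_max_left _ _

/-! ### The genera from the Euler equation -/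

theorem mainTheorem9 :
    (graphM4.maxGenus = 7 ∧ graphM5.maxGenus = 9 ∧ graphM6.maxGenus = 10) ∧
    (graphM4.UpperEmbeddable ∧ graphM5.UpperEmbeddable ∧ graphM6.UpperEmbeddable) ∧
    (graphM4.minGenus = 4 ∧ graphM5.minGenus = 5 ∧ graphM6.minGenus = 6) ∧
    (¬ graphM4.maxGenus ≥ 2 * graphM4.minGenus ∧
      ¬ graphM5.maxGenus ≥ 2 * graphM5.minGenus ∧
      ¬ graphM6.maxGenus ≥ 2 * graphM6.minGenus) := by
  obtain ⟨R42, h42⟩ := isValid_rotationM4Two.exists_numFaces_eq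
  obtain ⟨R48, h48⟩ := isValid_rotationM4Eight.exists_numFaces_eq
  obtain ⟨R51, h51⟩ := isValid_rotationM5One.exists_numFaces_eq
  obtain ⟨R59, h59⟩ := isValid_rotationM5Nine.exists_numFaces_eq
  obtain ⟨R62, h62⟩ := isValid_rotationM6Two.exists_numFaces_eq
  obtain ⟨R610, h610⟩ := isValid_rotationM6Ten.exists_numFaces_eq
  -- The pairs of vertex and edge numbers are (28, 42), (35, 52) and (40, 60).
  have e4 : ∀ k, graphM4.CellularEmbedsIn k ↔
      ∃ R : graphM4.RotationSystem, (R.numFaces : ℤ) = 16 - 2 * k := fun k => by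
    rw [CellularEmbedsIn, card_edgeSet_graphM4, and_iff_right graphM4_connected]
    refine exists_congr fun R => ?_
    simp only [Nat.card_eq_fintype_card, Fintype.card_sum, Fintype.card_prod, Fintype.card_fin]
    omega
  have e5 : ∀ k, graphM5.CellularEmbedsIn k ↔
      ∃ R : graphM5.RotationSystem, (R.numFaces : ℤ) = 19 - 2 * k := fun k => by
    rw [CellularEmbedsIn, card_edgeSet_graphM5, and_iff_right graphM5_connected]
    refine exists_congr fun R => ?_
    simp only [Nat.card_eq_fintype_card, Fintype.card_sum, Fintype.card_prod, Fintype.card_fin]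
    omega
  have e6 : ∀ k, graphM6.CellularEmbedsIn k ↔
      ∃ R : graphM6.RotationSystem, (R.numFaces : ℤ) = 22 - 2 * k := fun k => by
    rw [CellularEmbedsIn, card_edgeSet_graphM6, and_iff_right graphM6_connected]
    refine exists_congr fun R => ?_
    simp only [Nat.card_eq_fintype_card, Fintype.card_sum, Fintype.card_prod, Fintype.card_fin]
    omega
  have max4 : graphM4.maxGenus = 7 := maxGenus_eq ((e4 7).mpr ⟨R42, by simp [h42]⟩) fun l hl => by
    obtain ⟨R, hR⟩ := (e4 l).mp hl
    have := R.one_le_numFaces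
    omega
  have max5 : graphM5.maxGenus = 9 := maxGenus_eq ((e5 9).mpr ⟨R51, by simp [h51]⟩) fun l hl => by
    obtain ⟨R, hR⟩ := (e5 l).mp hl
    have := R.one_le_numFaces
    omega
  have max6 : graphM6.maxGenus = 10 :=
    maxGenus_eq ((e6 10).mpr ⟨R62, by simp [h62]⟩) fun l hl => by
      obtain ⟨R, hR⟩ := (e6 l).mp hl
      have := R.one_le_numFaces
      omega
  -- Parity enters here: the number of faces is even and at most 9, so at most 8. For `graphM5` and
  -- `graphM6` it lowers 10 to 9 and 11 to 10 in the same way.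
  have min4 : graphM4.minGenus = 4 := minGenus_eq ((e4 4).mpr ⟨R48, by simp [h48]⟩) fun l hl => by
    obtain ⟨R, hR⟩ := (e4 l).mp hl
    have := graphM4_numFaces_le R
    omega
  have min5 : graphM5.minGenus = 5 := minGenus_eq ((e5 5).mpr ⟨R59, by simp [h59]⟩) fun l hl => by
    obtain ⟨R, hR⟩ := (e5 l).mp hl
    have := graphM5_numFaces_le R
    omega
  have min6 : graphM6.minGenus = 6 :=
    minGenus_eq ((e6 6).mpr ⟨R610, by simp [h610]⟩) fun l hl => by
      obtain ⟨R, hR⟩ := (e6 l).mp hl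
      have := graphM6_numFaces_le R
      omega
  rw [max4, max5, max6, min4, min5, min6]
  exact ⟨⟨rfl, rfl, rfl⟩, ⟨⟨graphM4_connected, R42, .inr h42⟩, ⟨graphM5_connected, R51, .inl h51⟩,
    ⟨graphM6_connected, R62, .inr h62⟩⟩, ⟨rfl, rfl, rfl⟩, by decide⟩
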